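/- Let $\Gamma$ be a connected simplicial graph with countable vertex set $V(\Gamma)$, with graph metric $d$. Suppose that * $\Gamma$ is hyperbolic: with $(x,y)_w=\frac12\big(d(x,w)+d(y,w)-d(x,y)\big)$, there is $\delta\in\mathbb N$ such that $(x,z)_w\ge\min\{(x,y)_w,(y,z)_w\}-\delta$ for all vertices $w,x,y,z$; * $\Gamma$ is uniformly fine: there is a function $f\colon\mathbb N\to\mathbb N$ such that for every edge $e$ and every $n\in\mathbb N$ there are at most $f(n)$ circuits (closed paths of length at least $3$ without self-intersection other than the common endpoint) of length at most $n$ containing $e$; * the girth of $\Gamma$ (the minimal length of a circuit, $\infty$ if there is none) is greater than $20$. Let $\mathcal G=\{G_v\}_{v\in V(\Gamma)}$ be a collection of non-trivial finite groups, and let $\Gamma\mathcal G$ be the graph product, i.e. the quotient of the free product $\ast_{v\in V(\Gamma)}G_v$ by the normal subgroup generated by all commutators $[g_v,g_w]$ with $v,w$ adjacent, $g_v\in G_v$, $g_w\in G_w$. For a vertex $v$ let $\mathrm{Lk}_\Gamma(v)$ be the set of vertices adjacent to $v$. Then $\Gamma\mathcal G$ is bi-exact relative to the collection of subgroups $$\mathcal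 F=\{\,\langle G_w\mid w\in\mathrm{Lk}_\Gamma(v)\rangle\,\}_{v\in V(\Gamma)}.$$ Explicitly, writing $G=\Gamma\mathcal G$, $\mathrm{Prob}(G)\subset\ell^1(G)$ for the set of probability measures on $G$, and $(s.m)(x)=m(s^{-1}x)$, this means the following. 1. $G$ is exact: $G$ acts by homeomorphisms on some non-empty compact Hausdorff space $K$ so that for every finite $F\subset G$ and every $\varepsilon>0$ there is a map $m\colon K\to\mathrm{Prob}(G)$, continuous for the weak-$*$ topology of $\ell^1(G)=c_0(G)^*$, with $\max_{g\in F}\sup_{x\in K}\|m(gx)-g.m(x)\|_1<\varepsilon$. 2. There is a map $\mu\colon G\to\mathrm{Prob}(G)$ such that for all $s,t\in G$ and all $\varepsilon>0$ the set $\{x\in G\mid \|\mu(sxt)-s.\mu(x)\|_1\ge\varepsilon\}$ is contained in a union of finitely many sets $aHb$ with $a,b\in G$ and $H\in\mathcal F$. -/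

import Mathlib

open Filter Topology

universe u v

namespace RelBiexact

section Graphs

variable {V : Type u} (Γ : SimpleGraph V)

/-- The circuits of `Γ` (closed paths of length at least three without self-intersection except at
the common endpoint, regarded as paths, i.e. with a base point and a direction) that contain the
edge `e` and have length at most `n`. -/
def circuitsThrough (e : Sym2 V) (n : ℕ) : Set (Σ x : V, Γ.Walk x x) :=
  {p | p.2.IsCycle ∧ e ∈ p.2.edges ∧ p.2.length ≤ n}

/-- `Γ` is uniformly fine: the number of circuits of length at most `n` through an edge is bounded
by a (finite) number that depends only on `n`. -/
def UniformlyFine : Prop :=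
  ∃ f : ℕ → ℕ, ∀ e ∈ Γ.edgeSet, ∀ n : ℕ, (circuitsThrough Γ e n).encard ≤ (f n : ℕ∞)

/-- The Gromov product `(x, y)_z` with respect to the graph metric. -/
noncomputable def gromovProduct (x y z : V) : ℝ :=
  ((Γ.dist x z : ℝ) + (Γ.dist y z : ℝ) - (Γ.dist x y : ℝ)) / 2

/-- A hyperbolic graph: a connected graph whose graph metric is Gromov hyperbolic. -/
def Hyperbolic : Prop :=
  Γ.Connected ∧ ∃ δ : ℕ, ∀ w x y z : V,
    min (gromovProduct Γ x y w) (gromovProduct Γ y z w) - (δ : ℝ) ≤ gromovProduct Γ x z w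

end Graphs

section GraphProducts

variable {V : Type u} (Γ : SimpleGraph V) (G : V → Type v) [∀ x, Group (G x)]

/-- The commutators, in the free product of the vertex groups, of elements of adjacent vertex
groups. -/
def commutationRelators : Set (Monoid.CoprodI G) :=
  {r | ∃ (x y : V) (a : G x) (b : G y), Γ.Adj x y ∧
    r = Monoid.CoprodI.of a * Monoid.CoprodI.of b *
      (Monoid.CoprodI.of a)⁻¹ * (Monoid.CoprodI.of b)⁻¹}

/-- The graph product of the vertex groups `G x` over `Γ`. -/
abbrev GraphProduct : Type (max u v) :=
  Monoid.CoprodI G ⧸ Subgroup.normalClosure (commutationRelators Γ G)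

/-- The canonical homomorphism of a vertex group to the graph product. -/
def vertexHom (x : V) : G x →* GraphProduct Γ G :=
  (QuotientGroup.mk' (Subgroup.normalClosure (commutationRelators Γ G))).comp Monoid.CoprodI.of

/-- The subgroup of the graph product generated by the vertex groups of the neighbours of `x`. -/
def linkSubgroup (x : V) : Subgroup (GraphProduct Γ G) :=
  Subgroup.closure (⋃ y ∈ Γ.neighborSet x, Set.range (vertexHom Γ G y))

end GraphProducts

/-- Probability measures on the discrete set `X`, given by their weights. -/
structure Prob (X : Type u) where
  weight : X → ℝ
  nonneg : ∀ x, 0 ≤ weight x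
  hasSum_one : HasSum weight 1

namespace Prob

/-- The weak-* topology, where `Prob X ⊆ ℓ¹(X)` and `ℓ¹(X)` is the dual of `c₀(X)`: the coarsest
topology for which all pairings with functions in `c₀(X)` are continuous. -/
noncomputable instance instTopologicalSpace {X : Type u} : TopologicalSpace (Prob X) :=
  TopologicalSpace.induced
    (fun (m : Prob X) (φ : {φ : X → ℂ // Tendsto φ cofinite (𝓝 0)}) =>
      ∑' x, (m.weight x : ℂ) * φ.1 x)
    inferInstance

/-- The distance `‖m - m'‖₁` in `ℓ¹(X)`. -/
noncomputable def l1Dist {X : Type u} (m m' : Prob X) : ℝ :=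
  ∑' x, |m.weight x - m'.weight x|

/-- The left translate `s.m` of a probability measure on a group, `(s.m)(x) = m(s⁻¹x)`. -/
def translate {G : Type u} [Group G] (s : G) (m : Prob G) : Prob G where
  weight x := m.weight (s⁻¹ * x)
  nonneg _ := m.nonneg _
  hasSum_one := (Equiv.mulLeft s⁻¹).hasSum_iff.mpr m.hasSum_one

end Prob

/-- Topological amenability of an action by homeomorphisms; the last clause says that
`max_{g ∈ F} sup_{x ∈ K} ‖m(gx) - g.m(x)‖₁ < ε`. -/
def TopologicallyAmenable (G : Type u) [Group G] (K : Type v) [TopologicalSpace K]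
    [MulAction G K] : Prop :=
  ∀ (F : Finset G) (ε : ℝ), 0 < ε → ∃ m : K → Prob G, Continuous m ∧
    ∃ c < ε, ∀ g ∈ F, ∀ x : K, Prob.l1Dist (m (g • x)) (Prob.translate g (m x)) ≤ c

/-- Exactness: the group has a topologically amenable action by homeomorphisms on some non-empty
compact Hausdorff space. -/
def IsExact (G : Type u) [Group G] : Prop :=
  ∃ (K : Type u) (_ : TopologicalSpace K) (_ : MulAction G K),
    Nonempty K ∧ CompactSpace K ∧ T2Space K ∧ ContinuousConstSMul G K ∧ TopologicallyAmenable G K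

section Relative

variable {G : Type u} [Group G]

/-- A set is small relative to a family of subgroups if it is covered by finitely many sets
`s H t` with `H` in the family. -/
def IsSmall (𝓕 : Set (Subgroup G)) (S : Set G) : Prop :=
  ∃ (n : ℕ) (s t : Fin n → G) (H : Fin n → Subgroup G), (∀ i, H i ∈ 𝓕) ∧
    S ⊆ ⋃ i, {g | ∃ h ∈ H i, g = s i * h * t i}

/-- `lim_{g → ∞/𝓕} f(g) = a`. -/
def TendstoRel (𝓕 : Set (Subgroup G)) (f : G → ℝ) (a : ℝ) : Prop :=
  ∀ ε : ℝ, 0 < ε → IsSmall 𝓕 {g | ε ≤ |f g - a|}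

/-- The group is bi-exact relative to the family `𝓕` of subgroups. -/
def BiexactRel (𝓕 : Set (Subgroup G)) : Prop :=
  IsExact G ∧ ∃ μ : G → Prob G, ∀ s t : G,
    TendstoRel 𝓕 (fun x => Prob.l1Dist (μ (s * x * t)) (Prob.translate s (μ x))) 0

end Relative

end RelBiexact

/-! Killing `G x` retracts the graph product onto `rest Γ G x`. The kernel is a free product of
conjugates of `G x` indexed by the walls of type `x`, the cosets of the link subgroup in `rest Γ G
x`. So every `g` has a reduced word `word x g` for each vertex `x`; left multiplication by `rest Γ G
x` permutes the walls in it, and right multiplication leaves it unchanged. Together these words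
detect special subgroups and count letters in a shortest expression (`exists_eval_eq`).

For the map `μ` it suffices to find a map to finitely supported nonnegative functions that is
equivariant up to bounded `ℓ¹`-errors and has proper mass; it is then normalised, and the
exceptional sets are even finite (`exists_tendstoRel_of_bounded_defect`). A point with finite
stabilizer carries an equivariant probability measure, `orbitMeasure`. By the girth bound, distinct
vertices have at most one common neighbour. Hence two distinct walls of one type have a finite
common stabilizer (`finite_stabilizer_pair`), and `special Γ G S` has finite stabilizers on the
walls of type `w` if at most one neighbour of `w` lies in `S` (`finite_stabilizer_of_subsingleton`).

The pairs of consecutive walls in `word x g` contribute mass one less than its length, with bounded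
defect. This controls the word lengths, but not the vertices that occur, of which there may be
infinitely many. Therefore each member `S` of an exhaustion of `V` by finite sets contributes one
further unit of mass when `g` lies outside `special Γ G (hull Γ S)`, exactly equivariantly for
`special Γ G S`. Bounded total mass then leaves finitely many vertices and bounded word lengths,
hence finitely many `g`.

Exactness follows from property A. Adding one vertex to a finite set gives an extension whose kernel
embeds in a free product of copies of a finite group; there, averages along the deletion of last
letters work (`hasPropertyA_freeCopies`). Property A passes to extensions and to groups that have it
locally, and it yields an amenable action on the space of ultrafilters. -/

namespace RelBiexact

/-! ### Mass and `ℓ¹`-norm of finitely supported functions -/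

section Finsupp

variable {X Y : Type*}

/-- The total mass of a finitely supported function. -/
noncomputable def mass : (X →₀ ℝ) →ₗ[ℝ] ℝ := Finsupp.linearCombination ℝ fun _ => (1 : ℝ)

/-- The `ℓ¹`-norm of a finitely supported function. -/
noncomputable def l1 (φ : X →₀ ℝ) : ℝ := φ.sum fun _ r => |r|

theorem mass_eq_sum (φ : X →₀ ℝ) {S : Finset X} (h : φ.support ⊆ S) : mass φ = ∑ x ∈ S, φ x := by
  rw [mass, Finsupp.linearCombination_apply, Finsupp.sum_of_support_subset _ h _ (by simp)]
  simp

theorem l1_eq_sum (φ : X →₀ ℝ) {S : Finset X} (h : φ.support ⊆ S) : l1 φ = ∑ x ∈ S, |φ x| := by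
  rw [l1, Finsupp.sum_of_support_subset _ h _ (by simp)]

@[simp] theorem mass_single (x : X) (r : ℝ) : mass (Finsupp.single x r) = r := by simp [mass]

@[simp] theorem l1_single (x : X) (r : ℝ) : l1 (Finsupp.single x r) = |r| := by simp [l1]

@[simp] theorem l1_zero : l1 (0 : X →₀ ℝ) = 0 := by simp [l1]

theorem l1_nonneg (φ : X →₀ ℝ) : 0 ≤ l1 φ := by
  rw [l1_eq_sum φ subset_rfl]; exact Finset.sum_nonneg fun _ _ => abs_nonneg _

theorem l1_add_le (φ ψ : X →₀ ℝ) : l1 (φ + ψ) ≤ l1 φ + l1 ψ := by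
  classical
  rw [l1_eq_sum (S := φ.support ∪ ψ.support) _ Finsupp.support_add,
    l1_eq_sum φ Finset.subset_union_left, l1_eq_sum ψ Finset.subset_union_right,
    ← Finset.sum_add_distrib]
  exact Finset.sum_le_sum fun x _ => abs_add_le _ _

@[simp] theorem l1_neg (φ : X →₀ ℝ) : l1 (-φ) = l1 φ := by
  rw [l1_eq_sum (-φ) (Finsupp.support_neg φ).subset, l1_eq_sum φ subset_rfl]; simp

theorem l1_sub_comm (φ ψ : X →₀ ℝ) : l1 (φ - ψ) = l1 (ψ - φ) := by
  rw [← l1_neg, neg_sub]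

theorem l1_sub_le (φ ψ : X →₀ ℝ) : l1 (φ - ψ) ≤ l1 φ + l1 ψ := by
  rw [sub_eq_add_neg]; simpa using l1_add_le φ (-ψ)

theorem l1_sub_le_add (φ ψ χ : X →₀ ℝ) : l1 (φ - χ) ≤ l1 (φ - ψ) + l1 (ψ - χ) := by
  simpa using l1_add_le (φ - ψ) (ψ - χ)

@[simp] theorem l1_smul (r : ℝ) (φ : X →₀ ℝ) : l1 (r • φ) = |r| * l1 φ := by
  rw [l1_eq_sum (S := φ.support) _ Finsupp.support_smul, l1_eq_sum φ subset_rfl]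
  simp [abs_mul, Finset.mul_sum]

theorem l1_sum_le {ι : Type*} (s : Finset ι) (φ : ι → X →₀ ℝ) :
    l1 (∑ i ∈ s, φ i) ≤ ∑ i ∈ s, l1 (φ i) := by
  classical
  induction s using Finset.induction_on with
  | empty => simp
  | insert a s ha ih =>
    rw [Finset.sum_insert ha, Finset.sum_insert ha]
    exact (l1_add_le _ _).trans (by gcongr)

theorem abs_mass_le (φ : X →₀ ℝ) : |mass φ| ≤ l1 φ := by
  rw [mass_eq_sum φ subset_rfl, l1_eq_sum φ subset_rfl]
  exact Finset.abs_sum_le_sum_abs _ _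

theorem l1_of_nonneg {φ : X →₀ ℝ} (h : 0 ≤ φ) : l1 φ = mass φ := by
  rw [mass_eq_sum φ subset_rfl, l1_eq_sum φ subset_rfl]
  exact Finset.sum_congr rfl fun x _ => abs_of_nonneg (h x)

theorem mass_nonneg {φ : X →₀ ℝ} (h : 0 ≤ φ) : 0 ≤ mass φ :=
  (l1_nonneg φ).trans_eq (l1_of_nonneg h)

@[simp] theorem mass_mapDomain (f : X → Y) (φ : X →₀ ℝ) :
    mass (Finsupp.mapDomain f φ) = mass φ := by
  simp [mass, Finsupp.linearCombination_mapDomain, Function.comp_def]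

theorem mapDomain_nonneg (f : X → Y) {φ : X →₀ ℝ} (h : 0 ≤ φ) : 0 ≤ Finsupp.mapDomain f φ := by
  rw [Finsupp.mapDomain]
  exact Finset.sum_nonneg fun x _ => by simpa using h x

theorem l1_mapDomain_le (f : X → Y) (φ : X →₀ ℝ) : l1 (Finsupp.mapDomain f φ) ≤ l1 φ := by
  rw [Finsupp.mapDomain, Finsupp.sum]
  refine (l1_sum_le _ _).trans ?_
  simp only [l1_single]
  rw [l1_eq_sum φ subset_rfl]

theorem l1_mapDomain_sub_le (f : X → Y) (φ ψ : X →₀ ℝ) :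
    l1 (Finsupp.mapDomain f φ - Finsupp.mapDomain f ψ) ≤ l1 (φ - ψ) := by
  have := l1_mapDomain_le f (φ - ψ)
  rwa [← Finsupp.lmapDomain_apply (M := ℝ) (R := ℝ), map_sub] at this

/-- The error splits into the difference of the functions and the difference of the masses, each at
most `C / mass ψ`. -/
theorem l1_normalize_sub_le {X : Type*} {φ ψ : X →₀ ℝ} (hφ : 0 ≤ φ) {C : ℝ}
    (h : l1 (φ - ψ) ≤ C) (h1 : 0 < mass φ) (h2 : 0 < mass ψ) :
    l1 ((mass φ)⁻¹ • φ - (mass ψ)⁻¹ • ψ) ≤ 2 * C / mass ψ := by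
  have e : (mass φ)⁻¹ • φ - (mass ψ)⁻¹ • ψ
      = (mass ψ)⁻¹ • (φ - ψ) + ((mass ψ - mass φ) / (mass φ * mass ψ)) • φ := by
    have : (mass ψ - mass φ) / (mass φ * mass ψ) = (mass φ)⁻¹ - (mass ψ)⁻¹ := by field_simp
    rw [this]; module
  have h3 : |mass ψ - mass φ| ≤ C := by
    rw [abs_sub_comm, ← map_sub]; exact (abs_mass_le _).trans h
  rw [e]
  refine (l1_add_le _ _).trans ?_
  rw [l1_smul, l1_smul, l1_of_nonneg hφ, abs_div, abs_of_pos (inv_pos.2 h2),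
    abs_of_pos (mul_pos h1 h2)]
  have : |mass ψ - mass φ| / (mass φ * mass ψ) * mass φ = |mass ψ - mass φ| / mass ψ := by
    field_simp
  rw [this, two_mul, add_div, inv_mul_eq_div]
  gcongr

end Finsupp

/-! ### Translation on a group -/

section Translate

variable {G : Type*} [Group G]

/-- The left translate of a finitely supported function on a group. -/
noncomputable def trans (s : G) : (G →₀ ℝ) →ₗ[ℝ] (G →₀ ℝ) := Finsupp.lmapDomain ℝ ℝ (s * ·)

theorem trans_apply (s : G) (φ : G →₀ ℝ) (x : G) : trans s φ x = φ (s⁻¹ * x) := by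
  have := Finsupp.mapDomain_apply (mul_right_injective s) φ (s⁻¹ * x)
  simpa [trans] using this

@[simp] theorem trans_one (φ : G →₀ ℝ) : trans 1 φ = φ := by ext; simp [trans_apply]

theorem trans_mul (s t : G) (φ : G →₀ ℝ) : trans (s * t) φ = trans s (trans t φ) := by
  ext; simp [trans_apply, mul_assoc]

@[simp] theorem mass_trans (s : G) (φ : G →₀ ℝ) : mass (trans s φ) = mass φ := by simp [trans]

theorem trans_nonneg (s : G) {φ : G →₀ ℝ} (h : 0 ≤ φ) : 0 ≤ trans s φ := mapDomain_nonneg _ h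

theorem l1_trans_le (s : G) (φ : G →₀ ℝ) : l1 (trans s φ) ≤ l1 φ := l1_mapDomain_le _ φ

theorem l1_trans_sub_le (s : G) (φ ψ : G →₀ ℝ) : l1 (trans s φ - trans s ψ) ≤ l1 (φ - ψ) :=
  l1_mapDomain_sub_le _ φ ψ

end Translate

namespace Prob

/-- The finitely supported probability measure with given weights. -/
noncomputable def ofFinsupp {X : Type u} (φ : X →₀ ℝ) (h : 0 ≤ φ) (h1 : mass φ = 1) : Prob X where
  weight := φ
  nonneg := h
  hasSum_one := by
    rw [← h1, mass_eq_sum φ subset_rfl]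
    exact hasSum_sum_of_ne_finset_zero fun x hx => by simpa using hx

theorem l1Dist_eq {X : Type u} {m m' : Prob X} {φ ψ : X →₀ ℝ} (h : m.weight = φ)
    (h' : m'.weight = ψ) : l1Dist m m' = l1 (φ - ψ) := by
  rw [l1Dist, l1_eq_sum (φ - ψ) subset_rfl, tsum_eq_sum (s := (φ - ψ).support), h, h']
  · simp
  · intro x hx
    simpa [h, h'] using hx

theorem translate_weight {G : Type u} [Group G] {m : Prob G} {φ : G →₀ ℝ} (h : m.weight = φ)
    (s : G) : (translate s m).weight = trans s φ := by
  ext x; simp [translate, trans_apply, h]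

end Prob

/-! ### From bounded defect and proper mass to almost equivariance -/

section Criterion

variable {G : Type u} [Group G]

theorem IsSmall.of_finite {𝓕 : Set (Subgroup G)} (h𝓕 : 𝓕.Nonempty) {S : Set G} (hS : S.Finite) :
    IsSmall 𝓕 S := by
  obtain ⟨H, hH⟩ := h𝓕
  refine ⟨hS.toFinset.card, fun i => (hS.toFinset.equivFin.symm i : G), fun _ => 1, fun _ => H,
    fun _ => hH, fun x hx => ?_⟩
  refine Set.mem_iUnion.2 ⟨hS.toFinset.equivFin ⟨x, by simpa using hx⟩, 1, H.one_mem, ?_⟩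
  simp

/-- A map into the finitely supported nonnegative functions that is equivariant up to bounded
errors and whose mass tends to infinity gives rise to the second half of bi-exactness. -/
theorem exists_tendstoRel_of_bounded_defect {𝓕 : Set (Subgroup G)} (h𝓕 : 𝓕.Nonempty)
    (Ψ : G → G →₀ ℝ) (hΨ : ∀ x, 0 ≤ Ψ x)
    (hdef : ∀ s t : G, ∃ C : ℝ, ∀ x, l1 (Ψ (s * x * t) - trans s (Ψ x)) ≤ C)
    (hfin : ∀ R : ℝ, {x | mass (Ψ x) ≤ R}.Finite) :
    ∃ μ : G → Prob G, ∀ s t : G,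
      TendstoRel 𝓕 (fun x => Prob.l1Dist (μ (s * x * t)) (Prob.translate s (μ x))) 0 := by
  classical
  let n : G → G →₀ ℝ := fun x => if 0 < mass (Ψ x) then (mass (Ψ x))⁻¹ • Ψ x
    else Finsupp.single 1 1
  have hn0 : ∀ x, 0 ≤ n x := by
    intro x
    by_cases h : 0 < mass (Ψ x)
    · simpa only [n, if_pos h] using smul_nonneg (inv_nonneg.2 h.le) (hΨ x)
    · simp [n, if_neg h]
  have hn1 : ∀ x, mass (n x) = 1 := by
    intro x
    by_cases h : 0 < mass (Ψ x)
    · simp [n, if_pos h, h.ne']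
    · simp [n, if_neg h]
  refine ⟨fun x => Prob.ofFinsupp (n x) (hn0 x) (hn1 x), fun s t ε hε => ?_⟩
  obtain ⟨C, hC⟩ := hdef s t
  have hC0 : 0 ≤ C := (l1_nonneg _).trans (hC 1)
  -- Mass above `2 * C / ε` makes the normalised error less than `ε`; the further summand `C` keeps
  -- the mass at `s * x * t` positive, so that neither side takes the default value.
  refine IsSmall.of_finite h𝓕 ((hfin (2 * C / ε + C)).subset fun x hx => ?_)
  by_contra hlt
  rw [Set.mem_ofPred_eq, not_le] at hlt
  change ε ≤ |Prob.l1Dist (Prob.ofFinsupp (n (s * x * t)) (hn0 _) (hn1 _))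
    (Prob.translate s (Prob.ofFinsupp (n x) (hn0 _) (hn1 _))) - 0| at hx
  rw [Prob.l1Dist_eq (φ := n (s * x * t)) (ψ := trans s (n x)) rfl
    (Prob.translate_weight rfl s), sub_zero, abs_of_nonneg (l1_nonneg _)] at hx
  have hd : 0 ≤ 2 * C / ε := by positivity
  have h2 : 0 < mass (Ψ x) := by linarith
  have h1 : 0 < mass (Ψ (s * x * t)) := by
    have := (abs_mass_le _).trans (hC x)
    rw [map_sub, mass_trans, abs_le] at this
    linarith
  have h2' : 0 < mass (trans s (Ψ x)) := by rwa [mass_trans]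
  have key := l1_normalize_sub_le (hΨ _) (hC x) h1 h2'
  simp only [n, if_pos h1, if_pos h2, map_smul] at hx
  rw [mass_trans] at key
  have : 2 * C / mass (Ψ x) < ε := by
    rw [div_lt_iff₀ h2, ← div_lt_iff₀' hε]; linarith
  linarith

end Criterion

/-! ### Reduced words in a free product of copies of one group -/

section FreeCopies

variable {Ω K : Type*} [Group K]

/-- The free product of copies of the group `K`, indexed by `Ω`. -/
abbrev FreeCopies (Ω K : Type*) [Group K] := Monoid.CoprodI fun _ : Ω => K

/-- The element `g` of the copy of `K` with index `ω`. -/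
def letter (ω : Ω) : K →* FreeCopies Ω K := Monoid.CoprodI.of (M := fun _ : Ω => K) (i := ω)

theorem FreeCopies.hom_ext {N : Type*} [Monoid N] {f g : FreeCopies Ω K →* N}
    (h : ∀ ω k, f (letter ω k) = g (letter ω k)) : f = g :=
  Monoid.CoprodI.ext_hom _ _ fun ω => MonoidHom.ext (h ω)

/-- Reduced words: no trivial letters, and consecutive letters lie in different copies. -/
def Reduced (L : List (Ω × K)) : Prop :=
  (∀ l ∈ L, l.2 ≠ 1) ∧ L.IsChain fun l l' => l.1 ≠ l'.1

/-- The element represented by a word. -/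
def listProd (L : List (Ω × K)) : FreeCopies Ω K := (L.map fun l => letter l.1 l.2).prod

@[simp] theorem listProd_nil : listProd ([] : List (Ω × K)) = 1 := rfl

@[simp] theorem listProd_cons (l : Ω × K) (L : List (Ω × K)) :
    listProd (l :: L) = letter l.1 l.2 * listProd L := by simp [listProd]

@[simp] theorem listProd_append (L L' : List (Ω × K)) :
    listProd (L ++ L') = listProd L * listProd L' := by simp [listProd]

open Classical in
/-- The reduced word that represents an element. -/
noncomputable def letters (f : FreeCopies Ω K) : List (Ω × K) :=
  (Monoid.CoprodI.Word.equiv f).toList.map fun l => (l.1, l.2)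

theorem reduced_letters (f : FreeCopies Ω K) : Reduced (letters f) := by
  classical
  refine ⟨fun l hl => ?_, ?_⟩
  · obtain ⟨p, hp, rfl⟩ := List.mem_map.1 hl
    exact (Monoid.CoprodI.Word.equiv f).ne_one p hp
  · exact (List.isChain_map _).2 (Monoid.CoprodI.Word.equiv f).chain_ne

theorem listProd_letters (f : FreeCopies Ω K) : listProd (letters f) = f := by
  classical
  conv_rhs => rw [← Monoid.CoprodI.Word.equiv.symm_apply_apply f]
  simp only [listProd, letters, List.map_map]
  rfl

theorem letters_listProd {L : List (Ω × K)} (h : Reduced L) : letters (listProd L) = L := by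
  classical
  let w : Monoid.CoprodI.Word fun _ : Ω => K :=
    ⟨L.map fun l => ⟨l.1, l.2⟩, fun l hl => by
      obtain ⟨p, hp, rfl⟩ := List.mem_map.1 hl
      exact h.1 p hp, (List.isChain_map _).2 h.2⟩
  have hw : listProd L = Monoid.CoprodI.Word.equiv.symm w := by
    change _ = w.prod
    simp only [listProd, Monoid.CoprodI.Word.prod, w, List.map_map]
    rfl
  rw [hw, letters, Equiv.apply_symm_apply]
  simp [w, Function.comp_def]

theorem letters_eq {L : List (Ω × K)} (h : Reduced L) {f : FreeCopies Ω K}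
    (hf : listProd L = f) : letters f = L := by rw [← hf, letters_listProd h]

@[simp] theorem letters_one : letters (1 : FreeCopies Ω K) = [] :=
  letters_eq ⟨by simp, by simp⟩ rfl

/-- Only the first letter is affected: the new letter is prepended, merged with it, or cancels it.
-/
theorem letters_letter_mul (ω : Ω) {g : K} (hg : g ≠ 1) (f : FreeCopies Ω K) :
    ((∀ l ∈ (letters f).head?, ω ≠ l.1) ∧ letters (letter ω g * f) = (ω, g) :: letters f) ∨
    ∃ h T, letters f = (ω, h) :: T ∧
      ((g * h ≠ 1 ∧ letters (letter ω g * f) = (ω, g * h) :: T) ∨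
        (g * h = 1 ∧ letters (letter ω g * f) = T)) := by
  classical
  have hr := reduced_letters f
  have hf := listProd_letters f
  by_cases H : ∀ l ∈ (letters f).head?, ω ≠ l.1
  · refine Or.inl ⟨H, letters_eq ⟨?_, ?_⟩ (by simp [hf])⟩
    · simpa [hg] using hr.1
    · exact List.isChain_cons.2 ⟨H, hr.2⟩
  · push Not at H
    obtain ⟨⟨ω', h⟩, hl, rfl⟩ := H
    obtain ⟨T, hT⟩ := List.head?_eq_some_iff.1 hl
    rw [hT] at hr hf
    refine Or.inr ⟨h, T, hT, ?_⟩
    have hrT : Reduced T := ⟨fun l hl => hr.1 l (List.mem_cons_of_mem _ hl),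
      (List.isChain_cons.1 hr.2).2⟩
    by_cases h1 : g * h = 1
    · refine Or.inr ⟨h1, letters_eq hrT ?_⟩
      rw [← hf, listProd_cons, ← mul_assoc, ← map_mul, h1, map_one, one_mul]
    · refine Or.inl ⟨h1, letters_eq (L := (ω, g * h) :: T) ⟨?_, List.isChain_cons.2
        ⟨fun y hy => (List.isChain_cons.1 hr.2).1 y hy, hrT.2⟩⟩ ?_⟩
      · simpa [h1] using hrT.1
      · rw [← hf, listProd_cons, listProd_cons, ← mul_assoc, ← map_mul]

theorem letters_mul_letter (ω : Ω) {g : K} (hg : g ≠ 1) (f : FreeCopies Ω K) :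
    ((∀ l ∈ (letters f).getLast?, l.1 ≠ ω) ∧
      letters (f * letter ω g) = letters f ++ [(ω, g)]) ∨
    ∃ h T, letters f = T ++ [(ω, h)] ∧
      ((h * g ≠ 1 ∧ letters (f * letter ω g) = T ++ [(ω, h * g)]) ∨
        (h * g = 1 ∧ letters (f * letter ω g) = T)) := by
  classical
  have hr := reduced_letters f
  have hf := listProd_letters f
  by_cases H : ∀ l ∈ (letters f).getLast?, l.1 ≠ ω
  · refine Or.inl ⟨H, letters_eq ⟨?_, ?_⟩ (by simp [hf])⟩
    · intro l hl
      rcases List.mem_append.1 hl with h | h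
      · exact hr.1 l h
      · rw [List.mem_singleton.1 h]; exact hg
    · exact List.isChain_append.2 ⟨hr.2, by simp, fun x hx y hy => by
        obtain rfl : (ω, g) = y := by simpa using hy
        exact H x hx⟩
  · push Not at H
    obtain ⟨⟨ω', h⟩, hl, rfl⟩ := H
    obtain ⟨T, hT⟩ := List.getLast?_eq_some_iff.1 hl
    rw [hT] at hr hf
    refine Or.inr ⟨h, T, hT, ?_⟩
    have hrT : Reduced T := ⟨fun l hl => hr.1 l (List.mem_append_left _ hl),
      (List.isChain_append.1 hr.2).1⟩
    by_cases h1 : h * g = 1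
    · refine Or.inr ⟨h1, letters_eq hrT ?_⟩
      rw [← hf, listProd_append, listProd_cons, listProd_nil, mul_one, mul_assoc, ← map_mul, h1,
        map_one, mul_one]
    · refine Or.inl ⟨h1, letters_eq ⟨?_, ?_⟩ ?_⟩
      · intro l hl
        rcases List.mem_append.1 hl with h | h
        · exact hrT.1 l h
        · rw [List.mem_singleton.1 h]; exact h1
      · refine List.isChain_append.2 ⟨hrT.2, by simp, fun x hx y hy => ?_⟩
        obtain rfl : (ω', h * g) = y := by simpa using hy
        exact (List.isChain_append.1 hr.2).2.2 x hx (ω', h) (by simp)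
      · rw [← hf, listProd_append, listProd_append, mul_assoc]
        simp

theorem length_letters_letter_mul_le (ω : Ω) (g : K) (f : FreeCopies Ω K) :
    (letters (letter ω g * f)).length ≤ (letters f).length + 1 := by
  by_cases hg : g = 1
  · simp [hg]
  rcases letters_letter_mul ω hg f with ⟨-, h⟩ | ⟨h, T, hT, ⟨-, h'⟩ | ⟨-, h'⟩⟩
  · simp [h]
  · simp [h', hT]
  · simp [h', hT]; omega

section Action

variable {B : Type*} [Group B] [MulAction B Ω]

/-- The endomorphism of a free product of copies of a group that permutes the copies. -/
def permHom (b : B) : FreeCopies Ω K →* FreeCopies Ω K :=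
  Monoid.CoprodI.lift fun ω => letter (b • ω)

@[simp] theorem permHom_letter (b : B) (ω : Ω) (g : K) :
    permHom b (letter ω g) = letter (b • ω) g :=
  Monoid.CoprodI.lift_of (M := fun _ : Ω => K) (fun ω => letter (b • ω)) g

variable (Ω K B) in
/-- The action on a free product of copies of a group by permutations of the copies. -/
def permAut : B →* MulAut (FreeCopies Ω K) where
  toFun b := MonoidHom.toMulEquiv (permHom b) (permHom b⁻¹)
    (FreeCopies.hom_ext fun ω k => by simp) (FreeCopies.hom_ext fun ω k => by simp)
  map_one' := by
    refine MulEquiv.toMonoidHom_injective (FreeCopies.hom_ext fun ω k => ?_)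
    change permHom (1 : B) (letter ω k) = letter ω k
    simp
  map_mul' a b := by
    refine MulEquiv.toMonoidHom_injective (FreeCopies.hom_ext fun ω k => ?_)
    change permHom (a * b) (letter ω k) = permHom a (permHom b (letter ω k))
    simp [mul_smul]

@[simp] theorem permAut_letter (b : B) (ω : Ω) (g : K) :
    permAut Ω K B b (letter ω g) = letter (b • ω) g := permHom_letter b ω g

theorem permAut_listProd (b : B) (L : List (Ω × K)) :
    permAut Ω K B b (listProd L) = listProd (L.map (Prod.map (b • ·) id)) := by
  induction L with
  | nil => simp
  | cons l L ih => simp [ih]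

theorem letters_permAut (b : B) (f : FreeCopies Ω K) :
    letters (permAut Ω K B b f) = (letters f).map (Prod.map (b • ·) id) := by
  have hr := reduced_letters f
  refine letters_eq ⟨fun l hl => ?_, ?_⟩ (by rw [← permAut_listProd, listProd_letters])
  · obtain ⟨p, hp, rfl⟩ := List.mem_map.1 hl
    exact hr.1 p hp
  · refine (List.isChain_map _).2 (hr.2.imp fun p q h => ?_)
    simpa using h

end Action

end FreeCopies

/-! ### Special subgroups, retractions and the splitting at a vertex -/

section GraphProductBasics

variable {V : Type u} {Γ : SimpleGraph V} {G : V → Type v} [∀ x, Group (G x)]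

theorem commute_vertexHom {x y : V} (h : Γ.Adj x y) (a : G x) (b : G y) :
    Commute (vertexHom Γ G x a) (vertexHom Γ G y b) := by
  have : Monoid.CoprodI.of a * Monoid.CoprodI.of b *
      (Monoid.CoprodI.of a)⁻¹ * (Monoid.CoprodI.of b)⁻¹ ∈
      Subgroup.normalClosure (commutationRelators Γ G) :=
    Subgroup.subset_normalClosure ⟨x, y, a, b, h, rfl⟩
  rw [← QuotientGroup.eq_one_iff] at this
  rw [Commute, SemiconjBy, ← mul_inv_eq_one, mul_inv_rev, ← mul_assoc]
  exact this

namespace GraphProduct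

/-- The universal property of the graph product. -/
def lift {N : Type*} [Group N] (h : ∀ x, G x →* N)
    (hc : ∀ x y, Γ.Adj x y → ∀ a b, Commute (h x a) (h y b)) : GraphProduct Γ G →* N :=
  QuotientGroup.lift _ (Monoid.CoprodI.lift h) <| by
    intro r hr
    have : Subgroup.normalClosure (commutationRelators Γ G) ≤ (Monoid.CoprodI.lift h).ker := by
      refine Subgroup.normalClosure_le_normal ?_
      rintro _ ⟨x, y, a, b, hxy, rfl⟩
      have := hc x y hxy a b
      simp only [SetLike.mem_coe, MonoidHom.mem_ker, map_mul, map_inv, Monoid.CoprodI.lift_of]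
      rw [this.eq]; group
    exact this hr

@[simp] theorem lift_vertexHom {N : Type*} [Group N] (h : ∀ x, G x →* N)
    (hc : ∀ x y, Γ.Adj x y → ∀ a b, Commute (h x a) (h y b)) (x : V) (a : G x) :
    lift h hc (vertexHom Γ G x a) = h x a :=
  Monoid.CoprodI.lift_of h a

theorem induction_left {P : GraphProduct Γ G → Prop} (x : GraphProduct Γ G) (one : P 1)
    (mul : ∀ (v : V) (g : G v) (y : GraphProduct Γ G), P y → P (vertexHom Γ G v g * y)) : P x := by
  induction x using QuotientGroup.induction_on with
  | H x =>
    induction x using Monoid.CoprodI.induction_left with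
    | one => exact one
    | mul g y ih => exact mul _ g _ ih

theorem hom_ext {N : Type*} [Group N] {f g : GraphProduct Γ G →* N}
    (h : ∀ v a, f (vertexHom Γ G v a) = g (vertexHom Γ G v a)) : f = g := by
  refine MonoidHom.ext fun x => ?_
  induction x using induction_left with
  | one => simp
  | mul v a y ih => rw [map_mul, map_mul, h, ih]

end GraphProduct

variable (Γ G) in
/-- The subgroup of the graph product generated by the vertex groups with index in `S`. -/
def special (S : Set V) : Subgroup (GraphProduct Γ G) :=
  Subgroup.closure (⋃ y ∈ S, Set.range (vertexHom Γ G y))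

theorem linkSubgroup_eq (x : V) : linkSubgroup Γ G x = special Γ G (Γ.neighborSet x) := rfl

theorem vertexHom_mem_special {S : Set V} {x : V} (h : x ∈ S) (a : G x) :
    vertexHom Γ G x a ∈ special Γ G S :=
  Subgroup.subset_closure (Set.mem_biUnion h ⟨a, rfl⟩)

theorem special_le {S : Set V} {K : Subgroup (GraphProduct Γ G)} :
    special Γ G S ≤ K ↔ ∀ y ∈ S, ∀ a, vertexHom Γ G y a ∈ K := by
  rw [special, Subgroup.closure_le, Set.iUnion₂_subset_iff]
  exact forall₂_congr fun y _ => Set.range_subset_iff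

theorem special_mono {S T : Set V} (h : S ⊆ T) : special Γ G S ≤ special Γ G T :=
  special_le.2 fun _ hy => vertexHom_mem_special (h hy)

theorem exists_finite_mem_special (x : GraphProduct Γ G) :
    ∃ S : Set V, S.Finite ∧ x ∈ special Γ G S := by
  induction x using GraphProduct.induction_left with
  | one => exact ⟨∅, Set.finite_empty, one_mem _⟩
  | mul v a y ih =>
    obtain ⟨S, hS, hy⟩ := ih
    exact ⟨insert v S, hS.insert v, mul_mem (vertexHom_mem_special (Set.mem_insert _ _) a)
      (special_mono (Set.subset_insert _ _) hy)⟩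

theorem special_empty : special Γ G ∅ = ⊥ :=
  le_bot_iff.1 (special_le.2 fun _ hy => hy.elim)

theorem special_singleton (u : V) : special Γ G {u} = (vertexHom Γ G u).range :=
  le_antisymm (special_le.2 fun y hy a => by obtain rfl : y = u := hy; exact ⟨a, rfl⟩) <| by
    rintro _ ⟨a, rfl⟩
    exact vertexHom_mem_special (Set.mem_singleton u) a

theorem finite_special_of_subsingleton [∀ x, Finite (G x)] {S : Set V} (hS : S.Subsingleton) :
    (special Γ G S : Set (GraphProduct Γ G)).Finite := by
  rcases hS.eq_empty_or_singleton with rfl | ⟨u, rfl⟩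
  · rw [special_empty]; simp
  · rw [special_singleton]; exact Set.finite_range _

open Classical in
variable (Γ G) in
/-- The retraction of the graph product to the subgroup `special Γ G S`. -/
noncomputable def retr (S : Set V) : GraphProduct Γ G →* GraphProduct Γ G :=
  GraphProduct.lift (fun y => if y ∈ S then vertexHom Γ G y else 1) fun x y h a b => by
    by_cases hx : x ∈ S <;> by_cases hy : y ∈ S <;>
      simp [hx, hy, commute_vertexHom h]

theorem retr_vertexHom_of_mem {S : Set V} {x : V} (h : x ∈ S) (a : G x) :
    retr Γ G S (vertexHom Γ G x a) = vertexHom Γ G x a := by simp [retr, h]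

theorem retr_vertexHom_of_notMem {S : Set V} {x : V} (h : x ∉ S) (a : G x) :
    retr Γ G S (vertexHom Γ G x a) = 1 := by simp [retr, h]

theorem retr_mem_inter {S T : Set V} {x : GraphProduct Γ G} (hx : x ∈ special Γ G T) :
    retr Γ G S x ∈ special Γ G (S ∩ T) := by
  suffices special Γ G T ≤ (special Γ G (S ∩ T)).comap (retr Γ G S) from this hx
  refine special_le.2 fun y hy a => ?_
  rw [Subgroup.mem_comap]
  by_cases h : y ∈ S
  · rw [retr_vertexHom_of_mem h]; exact vertexHom_mem_special (Set.mem_inter h hy) a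
  · rw [retr_vertexHom_of_notMem h]; exact one_mem _

theorem retr_mem (S : Set V) (x : GraphProduct Γ G) : retr Γ G S x ∈ special Γ G S := by
  obtain ⟨T, -, hT⟩ := exists_finite_mem_special x
  exact special_mono Set.inter_subset_left (retr_mem_inter hT)

theorem retr_of_mem {S : Set V} {x : GraphProduct Γ G} (hx : x ∈ special Γ G S) :
    retr Γ G S x = x := by
  suffices special Γ G S ≤ (retr Γ G S).eqLocus (MonoidHom.id _) from this hx
  exact special_le.2 fun y hy a => retr_vertexHom_of_mem hy a

variable (Γ G) in
/-- The subgroup generated by the vertex groups of the vertices different from `x`. -/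
abbrev rest (x : V) : Subgroup (GraphProduct Γ G) := special Γ G {x}ᶜ

theorem linkSubgroup_le_rest (x : V) : linkSubgroup Γ G x ≤ rest Γ G x :=
  special_mono fun y hy => by rintro rfl; exact Γ.irrefl hy

theorem commute_of_mem_linkSubgroup {x : V} {l : GraphProduct Γ G} (hl : l ∈ linkSubgroup Γ G x)
    (a : G x) : Commute l (vertexHom Γ G x a) := by
  suffices linkSubgroup Γ G x ≤ Subgroup.centralizer {vertexHom Γ G x a} by
    exact Subgroup.mem_centralizer_singleton_iff.1 (this hl)
  refine special_le.2 fun y hy b => Subgroup.mem_centralizer_singleton_iff.2 ?_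
  exact (commute_vertexHom hy a b).symm

variable (Γ G) in
/-- The cosets of the link subgroup of `x` in the subgroup `rest Γ G x`. -/
abbrev Walls (x : V) : Type (max u v) :=
  rest Γ G x ⧸ (linkSubgroup Γ G x).subgroupOf (rest Γ G x)

theorem walls_mk_eq {x : V} {a b : rest Γ G x} :
    (a : Walls Γ G x) = b ↔ (a : GraphProduct Γ G)⁻¹ * b ∈ linkSubgroup Γ G x := by
  rw [QuotientGroup.eq, Subgroup.mem_subgroupOf]; rfl

variable (Γ G) in
/-- The coset of the trivial element. -/
def baseWall (x : V) : Walls Γ G x := ((1 : rest Γ G x) : Walls Γ G x)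

theorem smul_baseWall {x : V} (b : rest Γ G x) : b • baseWall Γ G x = (b : Walls Γ G x) := by
  rw [baseWall, MulAction.Quotient.smul_coe, smul_eq_mul, mul_one]

variable (Γ G) in
/-- The semidirect product that the graph product is embedded into by `split`. -/
abbrev SplitGroup (x : V) : Type (max u v) :=
  FreeCopies (Walls Γ G x) (G x) ⋊[permAut (Walls Γ G x) (G x) (rest Γ G x)] rest Γ G x

open Classical in
/-- The homomorphism `split`, on the vertex groups. -/
noncomputable def splitGen (x y : V) : G y →* SplitGroup Γ G x :=
  if h : y = x then h.symm ▸ SemidirectProduct.inl.comp (letter (baseWall Γ G x))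
  else SemidirectProduct.inr.comp
    ((vertexHom Γ G y).codRestrict (rest Γ G x) fun a => vertexHom_mem_special h a)

theorem splitGen_self (x : V) (a : G x) : splitGen x x a =
    (SemidirectProduct.inl (letter (baseWall Γ G x) a) : SplitGroup Γ G x) := by
  simp [splitGen]

theorem splitGen_of_ne {x y : V} (h : y ≠ x) (a : G y) : splitGen x y a =
    (SemidirectProduct.inr ⟨vertexHom Γ G y a, vertexHom_mem_special h a⟩ : SplitGroup Γ G x) := by
  simp only [splitGen, dif_neg h]; rfl

theorem commute_splitGen_self {x y : V} (h : Γ.Adj x y) (a : G x) (b : G y) :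
    Commute (splitGen x x a : SplitGroup Γ G x) (splitGen x y b) := by
  -- A neighbour of `x` lies in the link subgroup, so it fixes the base wall and commutes with the
  -- base copy of `G x`.
  have hfix : (⟨vertexHom Γ G y b, vertexHom_mem_special h.ne' b⟩ : rest Γ G x) • baseWall Γ G x
      = baseWall Γ G x := by
    rw [smul_baseWall, baseWall, eq_comm, walls_mk_eq]
    simpa [linkSubgroup_eq] using vertexHom_mem_special (Γ := Γ) (S := Γ.neighborSet x) h b
  rw [splitGen_self, splitGen_of_ne h.ne', Commute, SemiconjBy]
  ext1
  · simp [hfix]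
  · simp

/-- The splitting of the graph product as a semidirect product of a free product of copies of
`G x` and of the subgroup generated by the other vertex groups. -/
noncomputable def split (x : V) : GraphProduct Γ G →* SplitGroup Γ G x :=
  GraphProduct.lift (splitGen x) fun y z h a b => by
    by_cases hy : y = x
    · subst hy; exact commute_splitGen_self h a b
    by_cases hz : z = x
    · subst hz; exact (commute_splitGen_self h.symm b a).symm
    rw [splitGen_of_ne hy, splitGen_of_ne hz]
    have : Commute (⟨_, vertexHom_mem_special hy a⟩ : rest Γ G x)
        ⟨_, vertexHom_mem_special hz b⟩ := Subtype.ext (commute_vertexHom h a b)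
    exact this.map (SemidirectProduct.inr : rest Γ G x →* SplitGroup Γ G x)

@[simp] theorem split_vertexHom (x y : V) (a : G y) :
    split x (vertexHom Γ G y a) = splitGen x y a := by simp [split]

theorem split_of_mem {x : V} {b : GraphProduct Γ G} (hb : b ∈ rest Γ G x) :
    split x b = SemidirectProduct.inr ⟨b, hb⟩ := by
  have : (split (Γ := Γ) (G := G) x).comp (rest Γ G x).subtype = SemidirectProduct.inr := by
    refine MonoidHom.eq_of_eqOn_dense (Subgroup.closure_preimage_eq_top
      (⋃ y ∈ ({x}ᶜ : Set V), Set.range (vertexHom Γ G y))) ?_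
    rintro ⟨c, hc⟩ h
    obtain ⟨y, hy, a, rfl⟩ := Set.mem_iUnion₂.1 h
    exact (split_vertexHom x y a).trans (splitGen_of_ne hy a)
  exact DFunLike.congr_fun this ⟨b, hb⟩

/-- The free product component of an element of the graph product. -/
noncomputable def freePart (x : V) (g : GraphProduct Γ G) : FreeCopies (Walls Γ G x) (G x) :=
  (split x g).left

@[simp] theorem split_right (x : V) (g : GraphProduct Γ G) :
    ((split x g).right : GraphProduct Γ G) = retr Γ G {x}ᶜ g := by
  have : (rest Γ G x).subtype.comp (SemidirectProduct.rightHom.comp (split x)) =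
      retr Γ G {x}ᶜ := by
    refine GraphProduct.hom_ext fun y a => ?_
    by_cases h : y = x
    · subst h
      rw [retr_vertexHom_of_notMem (by simp)]
      simp [splitGen_self]
    · rw [retr_vertexHom_of_mem h]
      simp [splitGen_of_ne h]
  exact DFunLike.congr_fun this g

theorem freePart_mul (x : V) (g h : GraphProduct Γ G) :
    freePart x (g * h) = freePart x g * permAut _ _ _ (split x g).right (freePart x h) := by
  simp [freePart]

theorem freePart_of_mem {x : V} {b : GraphProduct Γ G} (hb : b ∈ rest Γ G x) :
    freePart x b = 1 := by rw [freePart, split_of_mem hb, SemidirectProduct.left_inr]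

theorem freePart_mul_of_mem {x : V} {b : GraphProduct Γ G} (hb : b ∈ rest Γ G x)
    (g : GraphProduct Γ G) : freePart x (b * g) =
      permAut _ _ (rest Γ G x) ⟨b, hb⟩ (freePart x g) := by
  rw [freePart_mul, freePart_of_mem hb, one_mul, split_of_mem hb, SemidirectProduct.right_inr]

theorem freePart_mul_of_mem_right {x : V} {b : GraphProduct Γ G} (hb : b ∈ rest Γ G x)
    (g : GraphProduct Γ G) : freePart x (g * b) = freePart x g := by
  rw [freePart_mul, freePart_of_mem hb, map_one, mul_one]

theorem freePart_vertexHom_mul (x : V) (a : G x) (g : GraphProduct Γ G) :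
    freePart x (vertexHom Γ G x a * g) = letter (baseWall Γ G x) a * freePart x g := by
  simp [freePart, splitGen_self]

theorem freePart_mul_vertexHom (x : V) (a : G x) (g : GraphProduct Γ G) :
    freePart x (g * vertexHom Γ G x a) =
      freePart x g * letter ((split x g).right • baseWall Γ G x) a := by
  have : freePart x (vertexHom Γ G x a) = letter (baseWall Γ G x) a := by
    simpa [freePart] using freePart_vertexHom_mul (Γ := Γ) x a 1
  rw [freePart_mul, this, permAut_letter]

/-- The homomorphism from the free product component back to the graph product. -/
noncomputable def unsplit (x : V) : FreeCopies (Walls Γ G x) (G x) →* GraphProduct Γ G :=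
  Monoid.CoprodI.lift fun ω =>
    (MulAut.conj ((Quotient.out ω : rest Γ G x) : GraphProduct Γ G)).toMonoidHom.comp
      (vertexHom Γ G x)

/-- The chosen coset representative is immaterial since the link subgroup commutes with `G x`. -/
theorem unsplit_letter (x : V) (b : rest Γ G x) (a : G x) :
    unsplit x (letter (b : Walls Γ G x) a) = b * vertexHom Γ G x a * (b : GraphProduct Γ G)⁻¹ := by
  obtain ⟨⟨l, hl⟩, h⟩ :=
    QuotientGroup.mk_out_eq_mul ((linkSubgroup Γ G x).subgroupOf (rest Γ G x)) b
  have e : unsplit x (letter (b : Walls Γ G x) a) =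
      ((Quotient.out (b : Walls Γ G x) : rest Γ G x) : GraphProduct Γ G) * vertexHom Γ G x a *
        ((Quotient.out (b : Walls Γ G x) : rest Γ G x) : GraphProduct Γ G)⁻¹ :=
    Monoid.CoprodI.lift_of (M := fun _ : Walls Γ G x => G x) _ a
  rw [e, h]
  have hc := commute_of_mem_linkSubgroup (Subgroup.mem_subgroupOf.1 hl) a
  simp only [Subgroup.coe_mul, mul_inv_rev, mul_assoc]
  rw [← mul_assoc (l : GraphProduct Γ G), hc.eq]
  group

theorem unsplit_permAut (x : V) (b : rest Γ G x) (f : FreeCopies (Walls Γ G x) (G x)) :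
    unsplit x (permAut _ _ _ b f) = b * unsplit x f * (b : GraphProduct Γ G)⁻¹ := by
  suffices (unsplit x).comp (permAut (Walls Γ G x) (G x) (rest Γ G x) b).toMonoidHom =
      (MulAut.conj (b : GraphProduct Γ G)).toMonoidHom.comp (unsplit x) from
    DFunLike.congr_fun this f
  refine FreeCopies.hom_ext fun ω a => ?_
  obtain ⟨c, rfl⟩ := QuotientGroup.mk_surjective ω
  simp only [MonoidHom.comp_apply, MulEquiv.toMonoidHom_eq_coe, MonoidHom.coe_coe, permAut_letter,
    MulAut.conj_apply, MulAction.Quotient.smul_coe, unsplit_letter, smul_eq_mul, Subgroup.coe_mul]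
  group

/-- This left inverse of `split`, checked on generators, shows that an element is determined by its
free part and its retraction. -/
theorem unsplit_mul_retr (x : V) (g : GraphProduct Γ G) :
    unsplit x (freePart x g) * retr Γ G {x}ᶜ g = g := by
  have h : (SemidirectProduct.lift (unsplit x) (rest Γ G x).subtype (fun b =>
      MonoidHom.ext fun f => unsplit_permAut x b f)).comp (split x) =
      MonoidHom.id (GraphProduct Γ G) := by
    refine GraphProduct.hom_ext fun y a => ?_
    by_cases hy : y = x
    · subst hy
      simp [splitGen_self, baseWall, unsplit_letter]
    · simp [splitGen_of_ne hy]
  have := DFunLike.congr_fun h g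
  rwa [MonoidHom.comp_apply, ← SemidirectProduct.inl_left_mul_inr_right (split x g), map_mul,
    SemidirectProduct.lift_inl, SemidirectProduct.lift_inr, Subgroup.subtype_apply,
    split_right] at this

/-- The reduced word of the free product component. -/
noncomputable def word (x : V) (g : GraphProduct Γ G) : List (Walls Γ G x × G x) :=
  letters (freePart x g)

theorem word_mul_of_mem {x : V} {b : GraphProduct Γ G} (hb : b ∈ rest Γ G x)
    (g : GraphProduct Γ G) :
    word x (b * g) = (word x g).map (Prod.map ((⟨b, hb⟩ : rest Γ G x) • ·) id) := by
  rw [word, freePart_mul_of_mem hb, letters_permAut, word]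

theorem word_mul_of_mem_right {x : V} {b : GraphProduct Γ G} (hb : b ∈ rest Γ G x)
    (g : GraphProduct Γ G) : word x (g * b) = word x g := by
  rw [word, freePart_mul_of_mem_right hb, word]

theorem word_of_mem {x : V} {b : GraphProduct Γ G} (hb : b ∈ rest Γ G x) : word x b = [] := by
  rw [word, freePart_of_mem hb, letters_one]

end GraphProductBasics

/-! ### Counting letters by vertex -/

section Occurrences

variable {V : Type u} {G : V → Type v}

open Classical in
/-- The number of letters of a word that belong to the vertex group with index `x`. -/
noncomputable def occ (x : V) (E : List (Σ x, G x)) : ℕ := E.countP fun l => l.1 = x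

@[simp] theorem occ_nil (x : V) : occ x ([] : List (Σ x, G x)) = 0 := rfl

theorem occ_cons_self (x : V) (a : G x) (E : List (Σ x, G x)) :
    occ x (⟨x, a⟩ :: E) = occ x E + 1 := by simp [occ]

theorem occ_cons_of_ne {x y : V} (h : y ≠ x) (a : G y) (E : List (Σ x, G x)) :
    occ x (⟨y, a⟩ :: E) = occ x E := by simp [occ, h]

@[simp] theorem occ_append (x : V) (E F : List (Σ x, G x)) :
    occ x (E ++ F) = occ x E + occ x F := by simp [occ]

theorem length_le_sum_occ (S : Finset V) {E : List (Σ x, G x)} (hE : ∀ l ∈ E, l.1 ∈ S) :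
    E.length ≤ ∑ x ∈ S, occ x E := by
  classical
  induction E with
  | nil => simp
  | cons l E ih =>
    have h : ∀ x, occ x (l :: E) = occ x E + if l.1 = x then 1 else 0 := fun x => by
      simp [occ, List.countP_cons]
    have hl := hE l (by simp)
    simp only [h, Finset.sum_add_distrib, Finset.sum_ite_eq, hl, if_true, List.length_cons]
    gcongr
    exact ih fun l hl => hE l (List.mem_cons_of_mem _ hl)

end Occurrences

/-! ### Shortest expressions -/

section Expressions

variable {V : Type u} {Γ : SimpleGraph V} {G : V → Type v} [∀ x, Group (G x)]

variable (Γ) in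
/-- The element of the graph product that is represented by a word in the vertex groups. -/
def eval (E : List (Σ x, G x)) : GraphProduct Γ G := (E.map fun l => vertexHom Γ G l.1 l.2).prod

@[simp] theorem eval_nil : eval Γ ([] : List (Σ x, G x)) = 1 := rfl

@[simp] theorem eval_cons (l : Σ x, G x) (E : List (Σ x, G x)) :
    eval Γ (l :: E) = vertexHom Γ G l.1 l.2 * eval Γ E := by simp [eval]

@[simp] theorem eval_append (E F : List (Σ x, G x)) :
    eval Γ (E ++ F) = eval Γ E * eval Γ F := by simp [eval]

theorem eval_mem_special {S : Set V} {E : List (Σ x, G x)} (h : ∀ l ∈ E, l.1 ∈ S) :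
    eval Γ E ∈ special Γ G S := by
  refine list_prod_mem fun x hx => ?_
  obtain ⟨l, hl, rfl⟩ := List.mem_map.1 hx
  exact vertexHom_mem_special (h l hl) _

theorem word_vertexHom_mul_of_ne {x y : V} (h : y ≠ x) (a : G y) (g : GraphProduct Γ G) :
    word x (vertexHom Γ G y a * g) = (word x g).map (Prod.map
      ((⟨_, vertexHom_mem_special h a⟩ : rest Γ G x) • ·) id) :=
  word_mul_of_mem (vertexHom_mem_special (S := {x}ᶜ) h a) g

/-- A letter at `x` lengthens the word by at most one; the other letters only move its walls. -/
theorem length_word_eval_le (x : V) (E : List (Σ x, G x)) :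
    (word x (eval Γ E)).length ≤ occ x E := by
  induction E with
  | nil => simp [word_of_mem (one_mem _)]
  | cons l E ih =>
    obtain ⟨y, a⟩ := l
    by_cases h : y = x
    · subst h
      rw [eval_cons, occ_cons_self, word, freePart_vertexHom_mul]
      exact (length_letters_letter_mul_le _ _ _).trans (by gcongr; exact ih)
    · rw [eval_cons, occ_cons_of_ne h, word_vertexHom_mul_of_ne h]
      simpa using ih

/-- If the word of `eval Γ E` at `x` is as long as possible and begins at the base wall, then the
letters of `E` before the first one at `x` multiply to an element of the link subgroup. -/
theorem exists_split_of_word_eq_cons {x : V} {E : List (Σ x, G x)}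
    (hE : (word x (eval Γ E)).length = occ x E) {h : G x} {T : List (Walls Γ G x × G x)}
    (hT : word x (eval Γ E) = (baseWall Γ G x, h) :: T) :
    ∃ E₁ E₂, E = E₁ ++ ⟨x, h⟩ :: E₂ ∧ eval Γ E₁ ∈ linkSubgroup Γ G x := by
  classical
  obtain ⟨⟨_, h'⟩, rfl, E₁, E₂, rfl, h₁⟩ : ∃ l : Σ x, G x, l.1 = x ∧ ∃ E₁ E₂, E = E₁ ++ l :: E₂ ∧
      ∀ l ∈ E₁, l.1 ≠ x := by
    have hpos : 0 < E.countP fun l => l.1 = x := by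
      rw [← occ, ← hE, hT]; simp
    obtain ⟨l, hl, hlx⟩ := List.countP_pos_iff.1 hpos
    cases hf : E.find? fun l => l.1 = x with
    | none => exact absurd hlx (by simpa using List.find?_eq_none.1 hf l hl)
    | some l' =>
      obtain ⟨hp, E₁, E₂, rfl, h₁⟩ := List.find?_eq_some_iff_append.1 hf
      exact ⟨l', by simpa using hp, E₁, E₂, rfl, by simpa using h₁⟩
  have hm : eval Γ E₁ ∈ rest Γ G _ := eval_mem_special (S := {_}ᶜ) h₁
  rename_i x
  have h₁' : occ x E₁ = 0 := by
    simpa [occ] using h₁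
  have hle := length_word_eval_le (Γ := Γ) x E₂
  rw [occ_append, occ_cons_self, h₁', eval_append, eval_cons, word_mul_of_mem hm, List.length_map,
    zero_add] at hE
  rw [eval_append, eval_cons, word_mul_of_mem hm] at hT
  simp only [word, freePart_vertexHom_mul] at hE hT hle
  -- A trivial letter could be dropped, leaving too few letters at `x` for the length of the word.
  have hh : h' ≠ 1 := by
    rintro rfl
    rw [map_one, one_mul] at hE
    omega
  -- Merging or cancelling would make the word shorter than `occ`. So the letter stays first, and
  -- its wall, the base wall moved by `eval Γ E₁`, is the base wall.
  rcases letters_letter_mul (baseWall Γ G x) hh (freePart x (eval Γ E₂)) with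
    ⟨-, e⟩ | ⟨k, T', hT', ⟨-, e⟩ | ⟨-, e⟩⟩
  · rw [e, List.map_cons, List.cons.injEq, Prod.map_apply, Prod.mk.injEq, smul_baseWall] at hT
    obtain ⟨⟨hb, rfl⟩, -⟩ := hT
    refine ⟨E₁, E₂, rfl, ?_⟩
    rw [baseWall, eq_comm, walls_mk_eq] at hb
    simpa using hb
  · rw [e] at hE; rw [hT'] at hle
    simp only [List.length_cons] at hE hle
    omega
  · rw [e] at hE; rw [hT'] at hle
    simp only [List.length_cons] at hE hle
    omega

/-- Every element has an expression with the minimal number of letters for each vertex. -/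
theorem exists_eval_eq (g : GraphProduct Γ G) :
    ∃ E, eval Γ E = g ∧ ∀ x, (word x g).length = occ x E := by
  induction g using GraphProduct.induction_left with
  | one => exact ⟨[], rfl, fun x => by simp [word_of_mem (one_mem _)]⟩
  | mul y a g ih =>
    obtain ⟨E, rfl, hE⟩ := ih
    by_cases ha : a = 1
    · exact ⟨E, by simp [ha], by simpa [ha] using hE⟩
    have hne : ∀ x, y ≠ x →
        (word x (vertexHom Γ G y a * eval Γ E)).length = occ x E := fun x h => by
      rw [word_vertexHom_mul_of_ne h, List.length_map, hE]
    have hy : word y (vertexHom Γ G y a * eval Γ E) =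
      letters (letter (baseWall Γ G y) a * freePart y (eval Γ E)) := by
        rw [word, freePart_vertexHom_mul]
    rcases letters_letter_mul (baseWall Γ G y) ha (freePart y (eval Γ E)) with
      ⟨-, e⟩ | ⟨h, T, hT, H⟩
    · refine ⟨⟨y, a⟩ :: E, by simp, fun x => ?_⟩
      by_cases h : y = x
      · subst h
        rw [hy, e, List.length_cons, occ_cons_self, ← hE, word]
      · rw [hne x h, occ_cons_of_ne h]
    · obtain ⟨E₁, E₂, rfl, hl⟩ := exists_split_of_word_eq_cons (hE y) hT
      have hl' := commute_of_mem_linkSubgroup hl a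
      have hT' := hE y
      rw [word, hT, occ_append, occ_cons_self, List.length_cons] at hT'
      rcases H with ⟨-, e⟩ | ⟨h1, e⟩
      · refine ⟨E₁ ++ ⟨y, a * h⟩ :: E₂, ?_, fun x => ?_⟩
        · rw [eval_append, eval_append, eval_cons, eval_cons, map_mul]
          simp only [← mul_assoc]
          rw [hl'.eq]
        · by_cases h : y = x
          · subst h
            rw [hy, e, List.length_cons, occ_append, occ_cons_self, hT']
          · rw [hne x h, occ_append, occ_append, occ_cons_of_ne h, occ_cons_of_ne h]
      · refine ⟨E₁ ++ E₂, ?_, fun x => ?_⟩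
        · rw [eval_append, eval_append, eval_cons, ← mul_assoc, ← mul_assoc, ← hl'.eq,
            mul_assoc (eval Γ E₁), ← map_mul, h1, map_one, mul_one]
        · by_cases h : y = x
          · subst h
            rw [hy, e, occ_append]
            omega
          · rw [hne x h, occ_append, occ_append, occ_cons_of_ne h]

theorem word_eq_nil {S : Set V} {x : V} (h : x ∉ S) {g : GraphProduct Γ G}
    (hg : g ∈ special Γ G S) : word x g = [] :=
  word_of_mem (special_mono (fun y hy => by rintro rfl; exact h hy) hg)

theorem mem_of_mem_of_word_eq_nil {S : Set V} {E : List (Σ x, G x)} {g : GraphProduct Γ G}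
    (hg : ∀ x ∉ S, word x g = []) (hE : ∀ x, (word x g).length = occ x E) :
    ∀ l ∈ E, l.1 ∈ S := by
  classical
  intro l hl
  by_contra h
  have := hE l.1
  rw [hg _ h, List.length_nil, eq_comm, occ, List.countP_eq_zero] at this
  exact this l hl (by simp)

/-- A shortest expression has no letters outside `S`. -/
theorem mem_special_of_word_eq_nil {S : Set V} {g : GraphProduct Γ G}
    (hg : ∀ x ∉ S, word x g = []) : g ∈ special Γ G S := by
  obtain ⟨E, rfl, hE⟩ := exists_eval_eq g
  exact eval_mem_special (mem_of_mem_of_word_eq_nil hg hE)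

theorem finite_word_ne_nil (g : GraphProduct Γ G) : {x | word x g ≠ []}.Finite := by
  obtain ⟨S, hS, hg⟩ := exists_finite_mem_special g
  exact hS.subset fun x hx => by_contra fun h => hx (word_eq_nil h hg)

/-- Shortest expressions of these elements have bounded length over a finite alphabet. -/
theorem finite_length_word_le [∀ x, Finite (G x)] {S : Set V} (hS : S.Finite) (N : ℕ) :
    {g : GraphProduct Γ G | g ∈ special Γ G S ∧ ∀ x, (word x g).length ≤ N}.Finite := by
  have : Finite S := hS
  let ι : (Σ x : S, G x) → Σ x, G x := fun l => ⟨l.1, l.2⟩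
  refine ((List.finite_length_le (Σ x : S, G x) (hS.toFinset.card * N)).image
    fun E => eval Γ (E.map ι)).subset ?_
  rintro g ⟨hg, hN⟩
  obtain ⟨E, rfl, hE⟩ := exists_eval_eq g
  have hm := mem_of_mem_of_word_eq_nil (fun x hx => word_eq_nil hx hg) hE
  have hlen := length_le_sum_occ hS.toFinset (E := E) (by simpa using hm)
  obtain ⟨F, rfl⟩ : ∃ F : List (Σ x : S, G x), F.map ι = E := by
    rw [← Set.mem_range, Set.range_list_map]
    exact fun l hl => ⟨⟨⟨l.1, hm l hl⟩, l.2⟩, rfl⟩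
  refine ⟨F, ?_, rfl⟩
  have : ∑ x ∈ hS.toFinset, occ x (F.map ι) ≤ hS.toFinset.card * N := by
    rw [← smul_eq_mul]
    exact Finset.sum_le_card_nsmul _ _ _ fun x _ => (hE x).symm.trans_le (hN x)
  simpa using hlen.trans this

end Expressions

/-! ### Finiteness of wall stabilizers -/

section Stabilizers

variable {V : Type u} {Γ : SimpleGraph V} {G : V → Type v} [∀ x, Group (G x)]

theorem smul_wall_eq_self {x : V} {b c : rest Γ G x} :
    b • (c : Walls Γ G x) = c ↔ (c : GraphProduct Γ G)⁻¹ * b * c ∈ linkSubgroup Γ G x := by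
  rw [MulAction.Quotient.smul_coe, eq_comm, walls_mk_eq, smul_eq_mul, Subgroup.coe_mul, mul_assoc]

/-- The stabilizer of the coset of `c` is conjugated by `c` into the link subgroup. Retracting to
`S` puts its part in `special Γ G S` into a conjugate of the special subgroup of `S ∩ Γ.neighborSet
x`, which is trivial or a vertex group. -/
theorem finite_stabilizer_of_subsingleton [∀ x, Finite (G x)] {S : Set V} {x : V}
    (hS : (S ∩ Γ.neighborSet x).Subsingleton) (ω : Walls Γ G x) :
    {b : rest Γ G x | (b : GraphProduct Γ G) ∈ special Γ G S ∧ b • ω = ω}.Finite := by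
  obtain ⟨c, rfl⟩ := QuotientGroup.mk_surjective ω
  let r := retr Γ G S c
  refine Set.Finite.subset (Set.Finite.preimage Subtype.val_injective.injOn
    ((finite_special_of_subsingleton (G := G) hS).image fun z => r * z * r⁻¹)) ?_
  rintro b ⟨hb, hbc⟩
  refine ⟨_, retr_mem_inter (S := S) (smul_wall_eq_self.1 hbc), ?_⟩
  simp only [map_mul, map_inv, retr_of_mem hb, r]
  group

/-- Two different walls of the same type have a finite common stabilizer if any two different
vertices have at most one common neighbour. -/
theorem finite_stabilizer_pair [∀ x, Finite (G x)]
    (h4 : ∀ x y, x ≠ y → (Γ.neighborSet x ∩ Γ.neighborSet y).Subsingleton) {x : V}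
    {ω ω' : Walls Γ G x} (hω : ω ≠ ω') : {b : rest Γ G x | b • ω = ω ∧ b • ω' = ω'}.Finite := by
  obtain ⟨c, rfl⟩ := QuotientGroup.mk_surjective ω
  obtain ⟨c', rfl⟩ := QuotientGroup.mk_surjective ω'
  set d : GraphProduct Γ G := (c : GraphProduct Γ G)⁻¹ * c' with hdd
  have hd : d ∈ rest Γ G x := (c⁻¹ * c').2
  have hdl : d ∉ linkSubgroup Γ G x := fun h => hω (walls_mk_eq.2 h)
  let ρ := retr Γ G (Γ.neighborSet x)
  -- Correcting `d` by an element of the link subgroup keeps it outside that subgroup and makes it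
  -- commute with every `l` there for which `d⁻¹ * l * d` is there too.
  let k := d * (ρ d)⁻¹
  have hk : k ∉ linkSubgroup Γ G x := fun h => hdl <| by
    simpa [k, ρ, linkSubgroup_eq] using mul_mem h (retr_mem (Γ.neighborSet x) d)
  have hkr : k ∈ rest Γ G x :=
    mul_mem hd (inv_mem (linkSubgroup_le_rest x (retr_mem (Γ.neighborSet x) d)))
  obtain ⟨y, hy, hyk⟩ : ∃ y, y ∉ Γ.neighborSet x ∧ word y k ≠ [] := by
    by_contra! h
    exact hk (mem_special_of_word_eq_nil h)
  have hyx : y ≠ x := by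
    rintro rfl
    exact hyk (word_of_mem hkr)
  obtain ⟨⟨η, a⟩, T, hT⟩ := List.exists_cons_of_ne_nil hyk
  have hfin := finite_stabilizer_of_subsingleton (h4 x y hyx.symm) η
  -- Compare the words of `l * k = k * l` at `y`: on the left all walls are moved by `l`, on the
  -- right none is. So `l` fixes the first wall `η`.
  have key : ∀ l ∈ linkSubgroup Γ G x, d⁻¹ * l * d ∈ linkSubgroup Γ G x →
      ∃ h : l ∈ rest Γ G y, (⟨l, h⟩ : rest Γ G y) • η = η := by
    intro l hl hl'
    have hlr : l ∈ rest Γ G y := special_mono (fun z hz => by rintro rfl; exact hy hz) hl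
    refine ⟨hlr, ?_⟩
    have e := retr_of_mem (Γ := Γ) (S := Γ.neighborSet x) hl'
    rw [map_mul, map_mul, map_inv, retr_of_mem (S := Γ.neighborSet x) hl] at e
    have hc : l * k = k * l := by
      change l * (d * (ρ d)⁻¹) = d * (ρ d)⁻¹ * l
      have : l * d = d * ((ρ d)⁻¹ * l * ρ d) := by rw [e]; group
      rw [← mul_assoc, this]; group
    have hw := word_mul_of_mem hlr k
    rw [hc, word_mul_of_mem_right hlr, hT, List.map_cons, List.cons.injEq, Prod.map_apply,
      Prod.mk.injEq] at hw
    exact hw.1.1.symm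
  refine Set.Finite.subset (Set.Finite.preimage (f := fun b : rest Γ G x =>
    (c : GraphProduct Γ G)⁻¹ * b * c) (Function.Injective.injOn fun b b' h => ?_)
    (hfin.image Subtype.val)) ?_
  · simpa using h
  · rintro b ⟨hb, hb'⟩
    rw [smul_wall_eq_self] at hb hb'
    obtain ⟨h, h'⟩ := key _ hb (by
      have : d⁻¹ * ((c : GraphProduct Γ G)⁻¹ * b * c) * d =
        (c' : GraphProduct Γ G)⁻¹ * b * c' := by rw [hdd]; group
      rwa [this])
    exact ⟨⟨_, h⟩, ⟨hb, h'⟩, rfl⟩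

end Stabilizers

/-! ### Equivariant measures from finite stabilizers -/

section OrbitMeasure

variable {A X G : Type*} [Group A] [MulAction A X] [Group G]

/-- The elements of the group that move the chosen representative of the orbit of `p` to `p`. -/
def transporter (A : Type*) {X : Type*} [Group A] [MulAction A X] (p : X) : Set A :=
  {a | a • Quotient.out (Quotient.mk (MulAction.orbitRel A X) p) = p}

/-- Both points have the same orbit representative. -/
theorem transporter_smul (s : A) (p : X) :
    transporter A (s • p) = (s * ·) '' transporter A p := by
  have h : Quotient.mk (MulAction.orbitRel A X) (s • p) = Quotient.mk _ p :=
    Quotient.sound (MulAction.mem_orbit p s)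
  ext a
  rw [Set.image_mul_left, Set.mem_preimage]
  simp only [transporter, h, Set.mem_ofPred_eq, mul_smul, inv_smul_eq_iff]

theorem transporter_nonempty (p : X) : (transporter A p).Nonempty := by
  obtain ⟨a, ha⟩ := Quotient.exact (Quotient.out_eq (Quotient.mk (MulAction.orbitRel A X) p))
  refine ⟨a⁻¹, ?_⟩
  change a⁻¹ • _ = p
  rw [inv_smul_eq_iff]
  exact ha.symm

theorem finite_transporter {p : X} (h : {a : A | a • p = p}.Finite) :
    (transporter A p).Finite := by
  obtain ⟨b, hb⟩ := transporter_nonempty (A := A) p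
  refine (h.image (· * b)).subset fun a ha => ⟨a * b⁻¹, ?_, by simp⟩
  have hb' : b⁻¹ • p = Quotient.out (Quotient.mk (MulAction.orbitRel A X) p) :=
    inv_smul_eq_iff.2 hb.symm
  change (a * b⁻¹) • p = p
  rw [mul_smul, hb']
  exact ha

/-- The push-forward to `G` of the uniform measure on the transporter of `p`, which is an
equivariant function of `p`. -/
noncomputable def orbitMeasure (j : A →* G) (p : X) : G →₀ ℝ :=
  ((transporter A p).ncard : ℝ)⁻¹ • ∑ᶠ a ∈ transporter A p, Finsupp.single (j a) 1

theorem orbitMeasure_smul (j : A →* G) (s : A) (p : X) :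
    orbitMeasure j (s • p) = trans (j s) (orbitMeasure j p) := by
  rw [orbitMeasure, orbitMeasure, transporter_smul,
    Set.ncard_image_of_injective _ (mul_right_injective s), map_smul]
  by_cases h : (transporter A p).Finite
  · rw [finsum_mem_image (mul_right_injective s).injOn]
    congr 1
    have := AddMonoidHom.map_finsum_mem (fun a => Finsupp.single (j a) (1 : ℝ))
      (trans (j s)).toAddMonoidHom h
    rw [LinearMap.toAddMonoidHom_coe] at this
    rw [this]
    simp [trans, Finsupp.mapDomain_single]
  · rw [Set.Infinite.ncard h]; simp

theorem orbitMeasure_nonneg (j : A →* G) (p : X) : 0 ≤ orbitMeasure j p := by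
  refine smul_nonneg (by positivity) ?_
  exact finsum_mem_induction (0 ≤ ·) le_rfl (fun _ _ => add_nonneg) fun a _ => by simp

theorem mass_orbitMeasure (j : A →* G) {p : X} (h : (transporter A p).Finite) :
    mass (orbitMeasure j p) = 1 := by
  have := AddMonoidHom.map_finsum_mem (fun a => Finsupp.single (j a) (1 : ℝ))
      (mass (X := G)).toAddMonoidHom h
  rw [LinearMap.toAddMonoidHom_coe] at this
  have hc : ((transporter A p).ncard : ℝ) ≠ 0 :=
    Nat.cast_ne_zero.2 (Set.ncard_ne_zero_of_mem (transporter_nonempty p).some_mem h)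
  rw [orbitMeasure, map_smul, this, finsum_mem_eq_finite_toFinset_sum _ h]
  simp [← Set.ncard_eq_toFinset_card _ h, hc]

/-- No finiteness is needed: an infinite transporter has `ncard` zero, so its measure is zero. -/
theorem l1_orbitMeasure_le (j : A →* G) (p : X) : l1 (orbitMeasure j p) ≤ 1 := by
  by_cases h : (transporter A p).Finite
  · rw [l1_of_nonneg (orbitMeasure_nonneg j p), mass_orbitMeasure j h]
  · rw [orbitMeasure, Set.Infinite.ncard h]; simp

end OrbitMeasure

/-! ### Measures from consecutive walls of one type -/

section Walls

variable {V : Type u} {Γ : SimpleGraph V} {G : V → Type v} [∀ x, Group (G x)]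

/-- The measure associated with two walls. -/
noncomputable def pairMeasure {x : V} (p : Walls Γ G x × Walls Γ G x) : GraphProduct Γ G →₀ ℝ :=
  orbitMeasure (rest Γ G x).subtype p

/-- The sum of the measures associated with the pairs of consecutive walls of a word. -/
noncomputable def chainMeasure {x : V} : List (Walls Γ G x × G x) → GraphProduct Γ G →₀ ℝ
  | [] => 0
  | [_] => 0
  | l :: l' :: L => trans (unsplit x (letter l.1 l.2))
      (pairMeasure (l.1, l'.1) + chainMeasure (l' :: L))

theorem chainMeasure_nonneg {x : V} (L : List (Walls Γ G x × G x)) : 0 ≤ chainMeasure L := by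
  induction L with
  | nil => exact le_rfl
  | cons l L ih =>
    cases L with
    | nil => exact le_rfl
    | cons l' L => exact trans_nonneg _ (add_nonneg (orbitMeasure_nonneg _ _) ih)

/-- Acting by `b` conjugates each letter by `b` under `unsplit`; the trailing `b⁻¹` cancels the
translation by `b` of the remaining terms. -/
theorem chainMeasure_map {x : V} (b : rest Γ G x) (L : List (Walls Γ G x × G x)) :
    chainMeasure (L.map (Prod.map (b • ·) id)) =
      trans (b : GraphProduct Γ G) (chainMeasure L) := by
  induction L with
  | nil => simp [chainMeasure]
  | cons l L ih =>
    cases L with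
    | nil => simp [chainMeasure]
    | cons l' L =>
      have h1 : unsplit x (letter (b • l.1) l.2) =
          b * unsplit x (letter l.1 l.2) * (b : GraphProduct Γ G)⁻¹ := by
        rw [← unsplit_permAut, permAut_letter]
      have h2 : pairMeasure (b • l.1, b • l'.1) = trans (b : GraphProduct Γ G)
          (pairMeasure (l.1, l'.1)) := orbitMeasure_smul (rest Γ G x).subtype b (l.1, l'.1)
      rw [List.map_cons] at ih
      simp only [List.map_cons, chainMeasure, Prod.map_fst, Prod.map_snd, id, ih, h1, h2, ← map_add]
      rw [← trans_mul, ← trans_mul]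
      simp

theorem mass_chainMeasure [∀ x, Finite (G x)]
    (h4 : ∀ x y, x ≠ y → (Γ.neighborSet x ∩ Γ.neighborSet y).Subsingleton) {x : V}
    (L : List (Walls Γ G x × G x)) (hL : L.IsChain fun l l' => l.1 ≠ l'.1) :
    mass (chainMeasure L) = (L.length - 1 : ℕ) := by
  induction L with
  | nil => simp [chainMeasure]
  | cons l L ih =>
    cases L with
    | nil => simp [chainMeasure]
    | cons l' L =>
      rw [List.isChain_cons_cons] at hL
      have h : mass (pairMeasure (l.1, l'.1)) = 1 :=
        mass_orbitMeasure _ <| finite_transporter <| by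
          simpa [Prod.ext_iff] using finite_stabilizer_pair h4 hL.1
      rw [chainMeasure, mass_trans, map_add, h, ih hL.2]
      simp [add_comm]

theorem l1_chainMeasure_cons_sub_le {x : V} (l : Walls Γ G x × G x)
    (L : List (Walls Γ G x × G x)) :
    l1 (chainMeasure (l :: L) - trans (unsplit x (letter l.1 l.2)) (chainMeasure L)) ≤ 1 := by
  cases L with
  | nil => simp [chainMeasure]
  | cons l' L =>
    rw [chainMeasure, map_add, add_sub_cancel_right]
    exact (l1_trans_le _ _).trans (l1_orbitMeasure_le _ _)

theorem chainMeasure_cons_mul {x : V} (ω : Walls Γ G x) (a h : G x)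
    (L : List (Walls Γ G x × G x)) :
    chainMeasure ((ω, a * h) :: L) =
      trans (unsplit x (letter ω a)) (chainMeasure ((ω, h) :: L)) := by
  cases L with
  | nil => simp [chainMeasure]
  | cons l' L => rw [chainMeasure, chainMeasure, map_mul, map_mul, trans_mul]

/-- Each pair is translated only by the letters up to its first wall, so the group element of the
last letter never enters. This gives almost invariance on the right. -/
theorem chainMeasure_append_congr {x : V} (ω : Walls Γ G x) (a h : G x)
    (L : List (Walls Γ G x × G x)) :
    chainMeasure (L ++ [(ω, a)]) = chainMeasure (L ++ [(ω, h)]) := by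
  induction L with
  | nil => simp [chainMeasure]
  | cons l L ih =>
    cases L with
    | nil => simp [chainMeasure]
    | cons l' L =>
      simp only [List.cons_append, chainMeasure] at ih ⊢
      rw [ih]

theorem l1_chainMeasure_append_sub_le {x : V} (l : Walls Γ G x × G x)
    (L : List (Walls Γ G x × G x)) : l1 (chainMeasure (L ++ [l]) - chainMeasure L) ≤ 1 := by
  induction L with
  | nil => simp [chainMeasure]
  | cons l' L ih =>
    cases L with
    | nil =>
      simp only [List.cons_append, List.nil_append, chainMeasure, sub_zero, add_zero]
      exact (l1_trans_le _ _).trans (l1_orbitMeasure_le _ _)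
    | cons l'' L =>
      simp only [List.cons_append, chainMeasure] at ih ⊢
      rw [← map_sub, add_sub_add_left_eq_sub]
      exact (l1_trans_le _ _).trans ih

/-- The sum of the measures associated with the pairs of consecutive walls of type `x` that
separate `g` from the trivial element. -/
noncomputable def wallMeasure (x : V) (g : GraphProduct Γ G) : GraphProduct Γ G →₀ ℝ :=
  chainMeasure (word x g)

theorem wallMeasure_mul_of_mem {x : V} {b : GraphProduct Γ G} (hb : b ∈ rest Γ G x)
    (g : GraphProduct Γ G) : wallMeasure x (b * g) = trans b (wallMeasure x g) := by
  rw [wallMeasure, word_mul_of_mem hb, chainMeasure_map, wallMeasure]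

theorem wallMeasure_mul_of_mem_right {x : V} {b : GraphProduct Γ G} (hb : b ∈ rest Γ G x)
    (g : GraphProduct Γ G) : wallMeasure x (g * b) = wallMeasure x g := by
  rw [wallMeasure, word_mul_of_mem_right hb, wallMeasure]

theorem unsplit_letter_baseWall (x : V) (a : G x) :
    unsplit x (letter (baseWall Γ G x) a) = vertexHom Γ G x a := by
  simp [baseWall, unsplit_letter]

theorem l1_wallMeasure_vertexHom_mul_le (x : V) (a : G x) (g : GraphProduct Γ G) :
    l1 (wallMeasure x (vertexHom Γ G x a * g) - trans (vertexHom Γ G x a) (wallMeasure x g)) ≤ 1 := by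
  by_cases ha : a = 1
  · simp [ha]
  rw [wallMeasure, wallMeasure, word, word, freePart_vertexHom_mul, ← unsplit_letter_baseWall]
  rcases letters_letter_mul (baseWall Γ G x) ha (freePart x g) with
    ⟨-, e⟩ | ⟨h, T, hT, ⟨-, e⟩ | ⟨h1, e⟩⟩
  · rw [e]; exact l1_chainMeasure_cons_sub_le (baseWall Γ G x, a) _
  · rw [e, hT, chainMeasure_cons_mul, sub_self, l1_zero]; exact zero_le_one
  -- Here a trivial letter precedes `T`; `chainMeasure` makes sense for such unreduced words too.
  · rw [e, hT, ← chainMeasure_cons_mul, h1, l1_sub_comm]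
    simpa using l1_chainMeasure_cons_sub_le (baseWall Γ G x, 1) T

theorem l1_wallMeasure_mul_vertexHom_le (x : V) (a : G x) (g : GraphProduct Γ G) :
    l1 (wallMeasure x (g * vertexHom Γ G x a) - wallMeasure x g) ≤ 1 := by
  by_cases ha : a = 1
  · simp [ha]
  rw [wallMeasure, wallMeasure, word, word, freePart_mul_vertexHom]
  rcases letters_mul_letter _ ha (freePart x g) with
    ⟨-, e⟩ | ⟨h, T, hT, ⟨-, e⟩ | ⟨h1, e⟩⟩
  · rw [e]; exact l1_chainMeasure_append_sub_le _ _
  · rw [e, hT, chainMeasure_append_congr _ _ h, sub_self, l1_zero]; exact zero_le_one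
  · rw [e, hT, l1_sub_comm]; exact l1_chainMeasure_append_sub_le _ _

theorem mass_wallMeasure [∀ x, Finite (G x)]
    (h4 : ∀ x y, x ≠ y → (Γ.neighborSet x ∩ Γ.neighborSet y).Subsingleton) (x : V)
    (g : GraphProduct Γ G) : mass (wallMeasure x g) = ((word x g).length - 1 : ℕ) :=
  mass_chainMeasure h4 _ (reduced_letters _).2

end Walls

/-! ### Measures from walls of distant types -/

section Far

variable {V : Type u} {Γ : SimpleGraph V} {G : V → Type v} [∀ x, Group (G x)]

variable (Γ) in
/-- The set `S` together with the vertices that have at least two neighbours in `S`. -/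
def hull (S : Set V) : Set V := S ∪ {w | ¬ (S ∩ Γ.neighborSet w).Subsingleton}

/-- Each pair of distinct vertices of `S` adds at most one common neighbour. -/
theorem finite_hull (h4 : ∀ x y, x ≠ y → (Γ.neighborSet x ∩ Γ.neighborSet y).Subsingleton)
    {S : Set V} (hS : S.Finite) : (hull Γ S).Finite := by
  refine hS.union ?_
  have : (⋃ p ∈ S ×ˢ S, {w | p.1 ≠ p.2 ∧ Γ.Adj p.1 w ∧ Γ.Adj p.2 w}).Finite := by
    refine (hS.prod hS).biUnion fun p _ => ?_
    by_cases hp : p.1 = p.2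
    · simp [hp]
    · exact (h4 p.1 p.2 hp).finite.subset fun w hw => hw.2
  refine this.subset fun w hw => ?_
  obtain ⟨y, hy, z, hz, hyz⟩ := Set.not_subsingleton_iff.1 hw
  exact Set.mem_biUnion (x := (y, z)) ⟨hy.1, hz.1⟩ ⟨hyz, hy.2.symm, hz.2.symm⟩

/-- The types outside `hull Γ S` of the walls that separate `g` from the trivial element. -/
def farTypes (S : Set V) (g : GraphProduct Γ G) : Set V := {w | w ∉ hull Γ S ∧ word w g ≠ []}

theorem mem_rest_of_notMem_hull {S : Set V} {w : V} (hw : w ∉ hull Γ S) {s : GraphProduct Γ G}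
    (hs : s ∈ special Γ G S) : s ∈ rest Γ G w :=
  special_mono (fun y hy => by rintro rfl; exact hw (Or.inl hy)) hs

theorem farTypes_mul {S : Set V} {s : GraphProduct Γ G} (hs : s ∈ special Γ G S)
    (g : GraphProduct Γ G) : farTypes S (s * g) = farTypes S g := by
  ext w
  refine and_congr_right fun hw => ?_
  rw [word_mul_of_mem (mem_rest_of_notMem_hull hw hs)]
  simp

theorem farTypes_mul_right {S : Set V} {s : GraphProduct Γ G} (hs : s ∈ special Γ G S)
    (g : GraphProduct Γ G) : farTypes S (g * s) = farTypes S g := by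
  ext w
  refine and_congr_right fun hw => ?_
  rw [word_mul_of_mem_right (mem_rest_of_notMem_hull hw hs)]

/-- The measure associated with the first wall of type `w`. -/
noncomputable def firstMeasure (S : Set V) (w : V) (g : GraphProduct Γ G) : GraphProduct Γ G →₀ ℝ :=
  match word w g with
  | [] => 0
  | l :: _ => orbitMeasure ((rest Γ G w).subtype.comp
      ((special Γ G S).subgroupOf (rest Γ G w)).subtype) l.1

open Classical in
/-- The measure associated with a first wall, of a type in `W`. -/
noncomputable def someFirstMeasure (S W : Set V) (g : GraphProduct Γ G) : GraphProduct Γ G →₀ ℝ :=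
  if h : W.Nonempty then firstMeasure S h.some g else 0

/-- The measure associated with a first wall, of a type outside `hull Γ S`. -/
noncomputable def farMeasure (S : Set V) (g : GraphProduct Γ G) : GraphProduct Γ G →₀ ℝ :=
  someFirstMeasure S (farTypes S g) g

/-- The chosen type depends only on the set `farTypes`, which is invariant under `special Γ G S`; so
the same type is used on both sides, and its first wall is moved by `s`. -/
theorem farMeasure_mul {S : Set V} {s : GraphProduct Γ G} (hs : s ∈ special Γ G S)
    (g : GraphProduct Γ G) : farMeasure S (s * g) = trans s (farMeasure S g) := by
  rw [farMeasure, farMeasure, farTypes_mul hs, someFirstMeasure, someFirstMeasure]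
  split_ifs with h
  · have hr := mem_rest_of_notMem_hull h.some_mem.1 hs
    rw [firstMeasure, firstMeasure, word_mul_of_mem hr]
    cases word h.some g with
    | nil => simp
    | cons l L => exact orbitMeasure_smul ((rest Γ G h.some).subtype.comp
        ((special Γ G S).subgroupOf (rest Γ G h.some)).subtype) ⟨⟨s, hr⟩, hs⟩ l.1
  · simp

theorem farMeasure_mul_right {S : Set V} {s : GraphProduct Γ G} (hs : s ∈ special Γ G S)
    (g : GraphProduct Γ G) : farMeasure S (g * s) = farMeasure S g := by
  rw [farMeasure, farMeasure, farTypes_mul_right hs, someFirstMeasure, someFirstMeasure]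
  split_ifs with h
  · rw [firstMeasure, firstMeasure,
      word_mul_of_mem_right (mem_rest_of_notMem_hull h.some_mem.1 hs)]
  · rfl

theorem firstMeasure_nonneg (S : Set V) (w : V) (g : GraphProduct Γ G) :
    0 ≤ firstMeasure S w g := by
  rw [firstMeasure]
  split
  · exact le_rfl
  · exact orbitMeasure_nonneg _ _

theorem farMeasure_nonneg (S : Set V) (g : GraphProduct Γ G) : 0 ≤ farMeasure S g := by
  rw [farMeasure, someFirstMeasure]
  split_ifs
  · exact firstMeasure_nonneg _ _ _
  · exact le_rfl

theorem l1_farMeasure_le (S : Set V) (g : GraphProduct Γ G) : l1 (farMeasure S g) ≤ 1 := by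
  rw [farMeasure, someFirstMeasure]
  split_ifs
  · rw [firstMeasure]
    split
    · simp
    · exact l1_orbitMeasure_le _ _
  · simp

theorem farMeasure_eq_zero {S : Set V} {g : GraphProduct Γ G}
    (hg : g ∈ special Γ G (hull Γ S)) : farMeasure S g = 0 := by
  rw [farMeasure, someFirstMeasure, dif_neg]
  rintro ⟨w, hw, hw'⟩
  exact hw' (word_eq_nil hw hg)

/-- Some type `w` outside the hull occurs. At most one neighbour of `w` is in `S`, so the stabilizer
in `special Γ G S` of its first wall is finite. -/
theorem mass_farMeasure [∀ x, Finite (G x)] {S : Set V} {g : GraphProduct Γ G}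
    (hg : g ∉ special Γ G (hull Γ S)) : mass (farMeasure S g) = 1 := by
  have h : (farTypes S g).Nonempty := by
    by_contra h
    refine hg (mem_special_of_word_eq_nil fun x hx => by_contra fun hx' => h ⟨x, hx, hx'⟩)
  rw [farMeasure, someFirstMeasure, dif_pos h, firstMeasure]
  have hw := h.some_mem
  generalize h.some = w at hw
  obtain ⟨hw, hw'⟩ := hw
  obtain ⟨l, L, hl⟩ := List.exists_cons_of_ne_nil hw'
  rw [hl]
  have hS : (S ∩ Γ.neighborSet w).Subsingleton := by
    by_contra h
    exact hw (Or.inr h)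
  refine mass_orbitMeasure _ (finite_transporter ?_)
  refine Set.Finite.subset (Set.Finite.preimage Subtype.val_injective.injOn
    (finite_stabilizer_of_subsingleton (G := G) hS l.1)) ?_
  rintro ⟨b, hb⟩ hbl
  exact ⟨hb, hbl⟩

end Far

/-! ### Bounded defect of sums and on generators -/

section Defect

theorem sum_mass_le {I : Type*} {X : Type*} {P : I → X →₀ ℝ} (hP : ∀ i, 0 ≤ P i)
    (hfin : {i | P i ≠ 0}.Finite) (J : Finset I) : ∑ i ∈ J, mass (P i) ≤ mass (∑ᶠ i, P i) := by
  classical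
  rw [finsum_eq_sum_of_support_subset (s := J ∪ hfin.toFinset) _ fun i hi => by
      simp only [Finset.coe_union, Set.Finite.coe_toFinset]; exact Or.inr hi, map_sum]
  exact Finset.sum_le_sum_of_subset_of_nonneg Finset.subset_union_left
    fun i _ _ => mass_nonneg (hP i)

variable {G : Type*} [Group G]

theorem exists_bounded_defect {I : Type*} {P : I → G → G →₀ ℝ}
    (hfin : ∀ x, {i | P i x ≠ 0}.Finite) {s t : G} (J : Finset I) {c : ℝ}
    (hJ : ∀ i ∉ J, ∀ x, P i (s * x * t) = trans s (P i x))
    (hc : ∀ i ∈ J, ∀ x, l1 (P i (s * x * t) - trans s (P i x)) ≤ c) :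
    ∃ C : ℝ, ∀ x, l1 ((∑ᶠ i, P i (s * x * t)) - trans s (∑ᶠ i, P i x)) ≤ C := by
  classical
  refine ⟨J.card • c, fun x => ?_⟩
  let U := J ∪ (hfin x).toFinset ∪ (hfin (s * x * t)).toFinset
  have h1 : ∑ᶠ i, P i (s * x * t) = ∑ i ∈ U, P i (s * x * t) :=
    finsum_eq_sum_of_support_subset _ fun i hi => by
      simp only [U, Finset.coe_union, Set.Finite.coe_toFinset]; exact Or.inr hi
  have h2 : ∑ᶠ i, P i x = ∑ i ∈ U, P i x :=
    finsum_eq_sum_of_support_subset _ fun i hi => by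
      simp only [U, Finset.coe_union, Set.Finite.coe_toFinset]; exact Or.inl (Or.inr hi)
  have hJU : J ⊆ U := fun i hi => by simp [U, hi]
  rw [h1, h2, map_sum, ← Finset.sum_sub_distrib,
    ← Finset.sum_subset hJU fun i _ hi => by rw [hJ i hi, sub_self]]
  exact (l1_sum_le _ _).trans (Finset.sum_le_card_nsmul _ _ _ fun i hi => hc i hi x)

variable {V : Type u} {Γ : SimpleGraph V} {G : V → Type v} [∀ x, Group (G x)]

/-- Defects add up along a product since translation does not increase the `ℓ¹`-norm. -/
theorem bounded_defect_of_generators (Ψ : GraphProduct Γ G → GraphProduct Γ G →₀ ℝ)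
    (hl : ∀ v a, ∃ C : ℝ, ∀ x, l1 (Ψ (vertexHom Γ G v a * x) -
      trans (vertexHom Γ G v a) (Ψ x)) ≤ C)
    (hr : ∀ v a, ∃ C : ℝ, ∀ x, l1 (Ψ (x * vertexHom Γ G v a) - Ψ x) ≤ C)
    (s t : GraphProduct Γ G) : ∃ C : ℝ, ∀ x, l1 (Ψ (s * x * t) - trans s (Ψ x)) ≤ C := by
  have hl' : ∃ C : ℝ, ∀ x, l1 (Ψ (s * x) - trans s (Ψ x)) ≤ C := by
    induction s using GraphProduct.induction_left with
    | one => exact ⟨0, by simp⟩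
    | mul v a s ih =>
      obtain ⟨C, hC⟩ := ih
      obtain ⟨D, hD⟩ := hl v a
      refine ⟨D + C, fun x => ?_⟩
      rw [mul_assoc, trans_mul]
      exact (l1_sub_le_add _ _ _).trans
        (add_le_add (hD (s * x)) ((l1_trans_sub_le _ _ _).trans (hC x)))
  have hr' : ∃ C : ℝ, ∀ x, l1 (Ψ (x * t) - Ψ x) ≤ C := by
    induction t using GraphProduct.induction_left with
    | one => exact ⟨0, by simp⟩
    | mul v a s ih =>
      obtain ⟨C, hC⟩ := ih
      obtain ⟨D, hD⟩ := hr v a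
      refine ⟨C + D, fun x => ?_⟩
      rw [← mul_assoc]
      exact (l1_sub_le_add _ _ _).trans (add_le_add (hC _) (hD x))
  obtain ⟨C, hC⟩ := hl'
  obtain ⟨D, hD⟩ := hr'
  exact ⟨D + C, fun x => (l1_sub_le_add _ _ _).trans (add_le_add (hD _) (hC x))⟩

end Defect

/-! ### The almost equivariant map -/

section Main

variable {V : Type u} {Γ : SimpleGraph V} {G : V → Type v} [∀ x, Group (G x)]

theorem exists_tendstoRel_graphProduct [Countable V] [∀ x, Finite (G x)]
    (h4 : ∀ x y, x ≠ y → (Γ.neighborSet x ∩ Γ.neighborSet y).Subsingleton)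
    {𝓕 : Set (Subgroup (GraphProduct Γ G))} (h𝓕 : 𝓕.Nonempty) :
    ∃ μ : GraphProduct Γ G → Prob (GraphProduct Γ G), ∀ s t,
      TendstoRel 𝓕 (fun x => Prob.l1Dist (μ (s * x * t)) (Prob.translate s (μ x))) 0 := by
  obtain ⟨e, he⟩ := exists_injective_nat V
  -- An exhaustion of `V` by finite sets; every element lies in `special Γ G (S m)` for all large
  -- `m`, where its far measure vanishes.
  let S : ℕ → Set V := fun m => {v | e v < m}
  have hS : ∀ m, (S m).Finite := fun m => (Set.finite_lt_nat m).preimage he.injOn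
  let P : V ⊕ ℕ → GraphProduct Γ G → GraphProduct Γ G →₀ ℝ :=
    Sum.elim wallMeasure fun m => farMeasure (S m)
  have hP0 : ∀ i x, 0 ≤ P i x := by
    rintro (v | m) x
    · exact chainMeasure_nonneg _
    · exact farMeasure_nonneg _ _
  have hfin : ∀ x, {i | P i x ≠ 0}.Finite := by
    intro x
    obtain ⟨T, hT, hx⟩ := exists_finite_mem_special x
    obtain ⟨N, hN⟩ := (hT.image e).bddAbove
    refine (((finite_word_ne_nil x).image Sum.inl).union
      ((Set.finite_le_nat N).image Sum.inr)).subset ?_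
    rintro (v | m) hi
    · refine Or.inl ⟨v, fun h => hi ?_, rfl⟩
      simp [P, wallMeasure, h, chainMeasure]
    · refine Or.inr ⟨m, ?_, rfl⟩
      by_contra h
      refine hi (farMeasure_eq_zero (special_mono (fun y hy => Or.inl ?_) hx))
      exact (hN ⟨y, hy, rfl⟩).trans_lt (not_le.1 h)
  have hmem : ∀ v (a : G v) m, e v < m → vertexHom Γ G v a ∈ special Γ G (S m) :=
    fun v a m h => vertexHom_mem_special (S := S m) h a
  -- The terms that may have a defect for generators at `v`: the walls of type `v`, and the far
  -- measures with `m ≤ e v`, that is, with `v ∉ S m`.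
  let J : V → Finset (V ⊕ ℕ) := fun v => ({v} : Finset V).disjSum (Finset.range (e v + 1))
  refine exists_tendstoRel_of_bounded_defect h𝓕 (fun x => ∑ᶠ i, P i x)
    (fun x => finsum_nonneg fun i => hP0 i x) ?_ fun R => ?_
  · refine bounded_defect_of_generators _ (fun v a => ?_) fun v a => ?_
    · have := exists_bounded_defect hfin (s := vertexHom Γ G v a) (t := 1) (J v) (c := 2) ?_ ?_
      · simpa using this
      · rintro (w | m) hi x
        · rw [mul_one]
          exact wallMeasure_mul_of_mem (vertexHom_mem_special
            (S := {w}ᶜ) (by rintro rfl; simp [J] at hi) a) x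
        · rw [mul_one]
          exact farMeasure_mul (hmem v a m (by simpa [J] using hi)) x
      · rintro (w | m) hi x
        · obtain rfl : w = v := by simpa [J] using hi
          rw [mul_one]
          exact (l1_wallMeasure_vertexHom_mul_le w a x).trans one_le_two
        · refine (l1_sub_le _ _).trans ?_
          rw [← one_add_one_eq_two]
          exact add_le_add (l1_farMeasure_le _ _)
            ((l1_trans_le _ _).trans (l1_farMeasure_le _ _))
    · have := exists_bounded_defect hfin (s := 1) (t := vertexHom Γ G v a) (J v) (c := 2) ?_ ?_
      · simpa using this
      · rintro (w | m) hi x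
        · rw [one_mul, trans_one]
          exact wallMeasure_mul_of_mem_right (vertexHom_mem_special
            (S := {w}ᶜ) (by rintro rfl; simp [J] at hi) a) x
        · rw [one_mul, trans_one]
          exact farMeasure_mul_right (hmem v a m (by simpa [J] using hi)) x
      · rintro (w | m) hi x
        · obtain rfl : w = v := by simpa [J] using hi
          rw [one_mul, trans_one]
          exact (l1_wallMeasure_mul_vertexHom_le w a x).trans one_le_two
        · refine (l1_sub_le _ _).trans ?_
          rw [← one_add_one_eq_two]
          exact add_le_add (l1_farMeasure_le _ _)
            ((l1_trans_le _ _).trans (l1_farMeasure_le _ _))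
  · obtain ⟨N, hN⟩ := exists_nat_gt R
    refine ((Set.finite_lt_nat N).biUnion fun m _ =>
      finite_length_word_le (G := G) (finite_hull h4 (hS m)) (N + 1)).subset fun x hx => ?_
    have hle : ∀ K : Finset (V ⊕ ℕ), ∑ i ∈ K, mass (P i x) ≤ R := fun K =>
      (sum_mass_le (fun i => hP0 i x) (hfin x) K).trans hx
    -- Otherwise the first `N` far measures alone have total mass `N`, which exceeds `R`.
    obtain ⟨m, hm, hxm⟩ : ∃ m < N, x ∈ special Γ G (hull Γ (S m)) := by
      by_contra! h
      have := hle ((Finset.range N).map ⟨Sum.inr, Sum.inr_injective⟩)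
      have h1 : ∀ m ∈ Finset.range N, mass (P (Sum.inr m) x) = 1 := fun m hm =>
        mass_farMeasure (h m (Finset.mem_range.1 hm))
      rw [Finset.sum_map] at this
      have this : ∑ m ∈ Finset.range N, mass (P (Sum.inr m) x) ≤ R := this
      rw [Finset.sum_congr rfl h1] at this
      simp only [Finset.sum_const, Finset.card_range, nsmul_eq_mul, mul_one] at this
      linarith
    refine Set.mem_biUnion hm ⟨hxm, fun v => ?_⟩
    have := (hle {Sum.inl v}).trans_lt hN
    rw [Finset.sum_singleton] at this
    have h' : mass (wallMeasure v x) < N := this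
    rw [mass_wallMeasure h4, Nat.cast_lt] at h'
    omega

end Main

/-! ### Permanence properties of property A -/

section PropertyA

/-- Property A of a discrete group, in terms of finitely supported probability measures. -/
def HasPropertyA (G : Type*) [Group G] : Prop :=
  ∀ (E : Set G) (ε : ℝ), E.Finite → 0 < ε → ∃ (F : Set G) (a : G → G →₀ ℝ), F.Finite ∧
    (∀ y, 0 ≤ a y) ∧ (∀ y, mass (a y) = 1) ∧ (∀ y, ∀ g ∈ (a y).support, y⁻¹ * g ∈ F) ∧
    ∀ y, ∀ g ∈ E, l1 (a (y * g) - a y) ≤ ε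

namespace HasPropertyA

variable {G H : Type*} [Group G] [Group H]

theorem of_subsingleton [Subsingleton G] : HasPropertyA G := fun E ε _ hε =>
  ⟨{1}, fun y => Finsupp.single y 1, Set.finite_singleton 1, fun y => by simp, fun y => by simp,
    fun y g _ => Subsingleton.elim _ _, fun y g _ => by
      rw [Subsingleton.elim (y * g) y, sub_self, l1_zero]; exact hε.le⟩

/-- The map is obtained by dividing by representatives of the right cosets of the image of `j`.
Pushing measures forward along it restricts property A to subgroups. -/
theorem exists_equivariant_map {j : H →* G} (hj : Function.Injective j) :
    ∃ p : G → H, ∀ h g, p (j h * g) = h * p g := by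
  let rep : G → G := fun g => Quotient.out (Quotient.mk (QuotientGroup.rightRel j.range) g)
  have hrep : ∀ g, ∃ h, g = j h * rep g := by
    intro g
    obtain ⟨h, hh⟩ := QuotientGroup.rightRel_apply.1
      (Quotient.exact (Quotient.out_eq (Quotient.mk (QuotientGroup.rightRel j.range) g)))
    exact ⟨h, by rw [hh]; simp [rep]⟩
  choose p hp using hrep
  refine ⟨p, fun h g => hj ?_⟩
  have e : rep (j h * g) = rep g := by
    have : Quotient.mk (QuotientGroup.rightRel j.range) (j h * g) = Quotient.mk _ g :=
      Quotient.sound (QuotientGroup.rightRel_apply.2 ⟨h⁻¹, by simp⟩)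
    simp only [rep, this]
  have h1 := hp (j h * g)
  rw [e] at h1
  conv_lhs at h1 => rw [hp g, ← mul_assoc]
  rw [map_mul]
  exact (mul_right_cancel h1).symm

theorem of_injective {j : H →* G} (hj : Function.Injective j) (hG : HasPropertyA G) :
    HasPropertyA H := by
  classical
  intro E ε hE hε
  obtain ⟨p, hp⟩ := exists_equivariant_map hj
  obtain ⟨F, a, hF, h0, h1, hs, ha⟩ := hG (j '' E) ε (hE.image j) hε
  refine ⟨p '' F, fun y => Finsupp.mapDomain p (a (j y)), hF.image p,
    fun y => mapDomain_nonneg _ (h0 _), fun y => by rw [mass_mapDomain, h1], fun y g hg => ?_,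
    fun y g hg => ?_⟩
  · obtain ⟨x, hx, rfl⟩ := Finset.mem_image.1 (Finsupp.mapDomain_support hg)
    refine ⟨_, hs _ x hx, ?_⟩
    rw [← map_inv, hp]
  · beta_reduce
    rw [map_mul]
    exact (l1_mapDomain_sub_le _ _ _).trans (ha _ _ ⟨g, hg, rfl⟩)

/-- Right multiplication by `E` preserves the left cosets of `H`, so the measures on `H` can be
copied to each coset separately. -/
theorem of_locally (h : ∀ E : Set G, E.Finite → ∃ H : Subgroup G, E ⊆ H ∧ HasPropertyA H) :
    HasPropertyA G := by
  classical
  intro E ε hE hε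
  obtain ⟨H, hEH, hH⟩ := h E hE
  obtain ⟨F, a, hF, h0, h1, hs, ha⟩ :=
    hH (Subtype.val ⁻¹' E) ε (hE.preimage Subtype.val_injective.injOn) hε
  let r : G → G := fun y => Quotient.out (y : G ⧸ H)
  have hr : ∀ y, (r y)⁻¹ * y ∈ H := fun y => QuotientGroup.eq.1 (Quotient.out_eq (y : G ⧸ H))
  refine ⟨Subtype.val '' F, fun y => Finsupp.mapDomain (fun h : H => r y * h) (a ⟨_, hr y⟩),
    hF.image _, fun y => mapDomain_nonneg _ (h0 _), fun y => by rw [mass_mapDomain, h1],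
    fun y g hg => ?_, fun y g hg => ?_⟩
  · obtain ⟨x, hx, rfl⟩ := Finset.mem_image.1 (Finsupp.mapDomain_support hg)
    refine ⟨_, hs _ x hx, ?_⟩
    simp [mul_assoc]
  · have e : r (y * g) = r y := by
      have : ((y * g : G) : G ⧸ H) = y := by
        rw [eq_comm, QuotientGroup.eq]; simpa using hEH hg
      simp only [r, this]
    have e' : (⟨_, hr (y * g)⟩ : H) = ⟨_, hr y⟩ * ⟨g, hEH hg⟩ :=
      Subtype.ext (by simp [e, mul_assoc])
    beta_reduce
    rw [e', e]
    exact (l1_mapDomain_sub_le _ _ _).trans (ha _ _ hg)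

end HasPropertyA

section Combination

variable {X Y : Type*}

theorem mass_linearCombination {ν : X → Y →₀ ℝ} (hν : ∀ x, mass (ν x) = 1) (φ : X →₀ ℝ) :
    mass (Finsupp.linearCombination ℝ ν φ) = mass φ := by
  rw [Finsupp.linearCombination_apply, Finsupp.sum, map_sum, mass_eq_sum φ subset_rfl]
  simp [hν]

theorem linearCombination_nonneg {ν : X → Y →₀ ℝ} (hν : ∀ x, 0 ≤ ν x) {φ : X →₀ ℝ} (hφ : 0 ≤ φ) :
    0 ≤ Finsupp.linearCombination ℝ ν φ := by
  rw [Finsupp.linearCombination_apply, Finsupp.sum]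
  exact Finset.sum_nonneg fun x _ => smul_nonneg (hφ x) (hν x)

theorem l1_linearCombination_le {ν : X → Y →₀ ℝ} (φ : X →₀ ℝ) {c : ℝ}
    (hν : ∀ x ∈ φ.support, l1 (ν x) ≤ c) :
    l1 (Finsupp.linearCombination ℝ ν φ) ≤ l1 φ * c := by
  rw [Finsupp.linearCombination_apply, Finsupp.sum, l1_eq_sum φ subset_rfl, Finset.sum_mul]
  refine (l1_sum_le _ _).trans (Finset.sum_le_sum fun x hx => ?_)
  rw [l1_smul]
  exact mul_le_mul_of_nonneg_left (hν x hx) (abs_nonneg _)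

end Combination

/-- The measure of `π y` picks a fibre, over `b`; inside that fibre, identified with the kernel by
`σ b`, a kernel measure is used. -/
theorem HasPropertyA.of_extension {A C : Type*} [Group A] [Group C] {π : A →* C}
    (hπ : Function.Surjective π) (hC : HasPropertyA C) (hN : HasPropertyA π.ker) :
    HasPropertyA A := by
  classical
  intro E ε hE hε
  let σ : C → A := Function.surjInv hπ
  have hσ : ∀ c, π (σ c) = c := Function.surjInv_eq hπ
  -- The position of `g` in kernel coordinates seen from the fibre over `c`. It satisfies the
  -- cocycle identity `e3`, which keeps the increments in the finite set `e (F, E)`.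
  let e : C → A → π.ker := fun c g => ⟨(σ c)⁻¹ * g * σ ((π g)⁻¹ * c), by
    simp [MonoidHom.mem_ker, hσ]⟩
  obtain ⟨F, a, hF, h0, h1, hs, ha⟩ := hC (π '' E) (ε / 2) (hE.image π) (half_pos hε)
  obtain ⟨F', a', hF', h0', h1', hs', ha'⟩ :=
    hN (Set.image2 e F E) (ε / 2) (hF.image2 e hE) (half_pos hε)
  let ν : A → C → A →₀ ℝ := fun y b => Finsupp.mapDomain (fun n : π.ker => σ b * n) (a' (e b y))
  have hν0 : ∀ y b, 0 ≤ ν y b := fun y b => mapDomain_nonneg _ (h0' _)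
  have hν1 : ∀ y b, mass (ν y b) = 1 := fun y b => by rw [mass_mapDomain, h1']
  refine ⟨Set.image2 (fun c (n : π.ker) => σ c * n) F F',
    fun y => Finsupp.linearCombination ℝ (ν y) (a (π y)), hF.image2 _ hF',
    fun y => linearCombination_nonneg (hν0 y) (h0 _),
    fun y => by rw [mass_linearCombination (hν1 y), h1], fun y g hg => ?_, fun y g hg => ?_⟩
  · beta_reduce at hg
    rw [Finsupp.linearCombination_apply] at hg
    obtain ⟨b, hb, hgb⟩ := Finset.mem_biUnion.1 (Finsupp.support_sum hg)
    obtain ⟨n, hn, rfl⟩ := Finset.mem_image.1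
      (Finsupp.mapDomain_support (Finsupp.support_smul hgb))
    refine ⟨_, hs _ b hb, _, hs' _ n hn, ?_⟩
    simp only [e, Subgroup.coe_mul, Subgroup.coe_inv]
    group
  · have e1 : Finsupp.linearCombination ℝ (ν (y * g)) (a (π (y * g))) -
        Finsupp.linearCombination ℝ (ν y) (a (π y)) =
        Finsupp.linearCombination ℝ (ν (y * g)) (a (π y * π g) - a (π y)) +
        Finsupp.linearCombination ℝ (fun b => ν (y * g) b - ν y b) (a (π y)) := by
      have e2 : Finsupp.linearCombination ℝ (fun b => ν (y * g) b - ν y b) (a (π y)) =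
          Finsupp.linearCombination ℝ (ν (y * g)) (a (π y)) -
          Finsupp.linearCombination ℝ (ν y) (a (π y)) := by
        simp [Finsupp.linearCombination_apply, Finsupp.sum, smul_sub, Finset.sum_sub_distrib]
      rw [e2, map_sub, map_mul]
      abel
    beta_reduce
    rw [e1, ← add_halves ε]
    refine (l1_add_le _ _).trans (add_le_add ?_ ?_)
    · refine (l1_linearCombination_le (c := 1) _ fun b _ => ?_).trans ?_
      · rw [l1_of_nonneg (hν0 _ b), hν1]
      · rw [mul_one]; exact ha _ _ ⟨g, hg, rfl⟩
    · refine (l1_linearCombination_le (c := ε / 2) _ fun b hb => ?_).trans ?_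
      · have e3 : e b (y * g) = e b y * e ((π y)⁻¹ * b) g := Subtype.ext <| by
          simp only [e, Subgroup.coe_mul, map_mul, mul_inv_rev]
          group
        simp only [ν, e3]
        exact (l1_mapDomain_sub_le _ _ _).trans (ha' _ _ ⟨_, hs _ b hb, g, hg, rfl⟩)
      · rw [l1_of_nonneg (h0 _), h1, one_mul]

end PropertyA

/-! ### Property A of free products of copies of a finite group -/

section FreeCopies

variable {Ω K : Type*} [Group K]

open Classical in
/-- Delete the last letter of a reduced word if its index is in `S`. -/
noncomputable def pull (S : Set Ω) (f : FreeCopies Ω K) : FreeCopies Ω K :=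
  match (letters f).getLast? with
  | none => f
  | some l => if l.1 ∈ S then f * letter l.1 l.2⁻¹ else f

theorem pull_eq {S : Set Ω} {f : FreeCopies Ω K} {ω : Ω} {k : K} {T : List (Ω × K)} (hω : ω ∈ S)
    (hT : letters f = T ++ [(ω, k)]) : pull S f = f * letter ω k⁻¹ := by
  simp [pull, hT, hω]

/-- Right multiplication by a letter with index in `S` adds, changes or removes a last letter that
`pull` deletes. So the orbits of the two elements under `pull` merge after at most one step each. -/
theorem pull_mul_letter {S : Set Ω} {ω : Ω} (hω : ω ∈ S) {k : K} (hk : k ≠ 1)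
    (f : FreeCopies Ω K) :
    pull S (f * letter ω k) = f ∨ pull S (f * letter ω k) = pull S f ∨
      f * letter ω k = pull S f := by
  rcases letters_mul_letter ω hk f with ⟨-, e⟩ | ⟨h, T, hT, ⟨-, e⟩ | ⟨h1, -⟩⟩
  · left; rw [pull_eq hω e, map_inv, mul_inv_cancel_right]
  · right; left; rw [pull_eq hω e, pull_eq hω hT, mul_assoc, ← map_mul]; group
  · right; right; rw [pull_eq hω hT, inv_eq_of_mul_eq_one_right h1]

theorem exists_finite_iterate_pull [Finite K] {S : Set Ω} (hS : S.Finite) (n : ℕ) :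
    ∃ F : Set (FreeCopies Ω K), F.Finite ∧ ∀ i < n, ∀ f, f⁻¹ * (pull S)^[i] f ∈ F := by
  have h1 : ∀ i, ∃ F : Set (FreeCopies Ω K), F.Finite ∧ ∀ f, f⁻¹ * (pull S)^[i] f ∈ F := by
    intro i
    induction i with
    | zero => exact ⟨{1}, Set.finite_singleton 1, fun f => by simp⟩
    | succ i ih =>
      obtain ⟨F, hF, h⟩ := ih
      let D : Set (FreeCopies Ω K) := insert 1 (Set.image2 (fun ω k => letter ω k) S Set.univ)
      have hD : D.Finite := (hS.image2 _ Set.finite_univ).insert 1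
      have hpull : ∀ f : FreeCopies Ω K, f⁻¹ * pull S f ∈ D := by
        intro f
        rw [pull]
        split
        · simp [D]
        · split_ifs with hl
          · rw [inv_mul_cancel_left]
            exact Or.inr ⟨_, hl, _, trivial, rfl⟩
          · simp [D]
      refine ⟨Set.image2 (· * ·) D F, hD.image2 _ hF, fun f => ⟨_, hpull f, _, h (pull S f), ?_⟩⟩
      rw [Function.iterate_succ_apply]
      group
  choose F hF h using h1
  exact ⟨⋃ i ∈ Set.Iio n, F i, (Set.finite_Iio n).biUnion fun i _ => hF i,
    fun i hi f => Set.mem_biUnion hi (h i f)⟩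

/-- The average of the first `n` iterates of `pull`. -/
noncomputable def pullAverage (S : Set Ω) (n : ℕ) (f : FreeCopies Ω K) : FreeCopies Ω K →₀ ℝ :=
  (n : ℝ)⁻¹ • ∑ i ∈ Finset.range n, Finsupp.single ((pull S)^[i] f) 1

/-- The sums telescope: only the first and the last iterate differ. -/
theorem l1_pullAverage_pull_sub_le (S : Set Ω) (n : ℕ) (f : FreeCopies Ω K) :
    l1 (pullAverage S n (pull S f) - pullAverage S n f) ≤ 2 / n := by
  have h := Finset.sum_range_sub (fun i => Finsupp.single ((pull S)^[i] f) (1 : ℝ)) n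
  simp only [Function.iterate_succ_apply, Finset.sum_sub_distrib] at h
  rw [pullAverage, pullAverage, ← smul_sub, h, l1_smul, abs_of_nonneg (by positivity),
    inv_mul_eq_div]
  gcongr
  refine (l1_sub_le _ _).trans ?_
  simp only [l1_single, abs_one]
  norm_num

theorem l1_pullAverage_mul_letter_sub_le {S : Set Ω} {ω : Ω} (hω : ω ∈ S) (k : K) (n : ℕ)
    (f : FreeCopies Ω K) :
    l1 (pullAverage S n (f * letter ω k) - pullAverage S n f) ≤ 4 / n := by
  have h24 : (2 : ℝ) / n ≤ 4 / n := by gcongr; norm_num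
  by_cases hk : k = 1
  · simp only [hk, map_one, mul_one, sub_self, l1_zero]; positivity
  have h1 := l1_pullAverage_pull_sub_le S n f
  have h2 := l1_pullAverage_pull_sub_le S n (f * letter ω k)
  rcases pull_mul_letter hω hk f with h | h | h
  · rw [h, l1_sub_comm] at h2; exact h2.trans h24
  · rw [h, l1_sub_comm] at h2
    refine (l1_sub_le_add _ _ _).trans ((add_le_add h2 h1).trans_eq ?_)
    ring
  · rw [h]; exact h1.trans h24

theorem l1_pullAverage_mul_listProd_sub_le {S : Set Ω} {L : List (Ω × K)} (hL : ∀ l ∈ L, l.1 ∈ S)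
    (n : ℕ) (f : FreeCopies Ω K) :
    l1 (pullAverage S n (f * listProd L) - pullAverage S n f) ≤ L.length * (4 / n) := by
  induction L generalizing f with
  | nil => simp
  | cons l L ih =>
    rw [listProd_cons, ← mul_assoc]
    refine (l1_sub_le_add _ _ _).trans ((add_le_add (ih (fun l hl => hL l
      (List.mem_cons_of_mem _ hl)) _) (l1_pullAverage_mul_letter_sub_le (hL l (by simp)) _ _ _)
      ).trans_eq ?_)
    rw [List.length_cons]; push_cast; ring

theorem hasPropertyA_freeCopies [Finite K] : HasPropertyA (FreeCopies Ω K) := by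
  classical
  intro E ε hE hε
  let S : Set Ω := ⋃ g ∈ E, {ω | ∃ l ∈ letters g, l.1 = ω}
  have hS : S.Finite := hE.biUnion fun g _ => (List.finite_toSet (letters g)).image Prod.fst
  obtain ⟨N, hN⟩ := (hE.image fun g => (letters g).length).bddAbove
  obtain ⟨n, hn⟩ := exists_nat_gt (N * 4 / ε)
  have hn0 : (0 : ℝ) < n := lt_of_le_of_lt (by positivity) hn
  obtain ⟨F, hF, h⟩ := exists_finite_iterate_pull (K := K) hS n
  refine ⟨F, pullAverage S n, hF, fun y => ?_, fun y => ?_, fun y g hg => ?_, fun y g hg => ?_⟩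
  · exact smul_nonneg (by positivity) (Finset.sum_nonneg fun i _ => by simp)
  · rw [pullAverage, map_smul, map_sum]
    simp [hn0.ne']
  · obtain ⟨i, hi, hg⟩ := Finset.mem_biUnion.1
      (Finsupp.support_finsetSum (Finsupp.support_smul hg))
    rw [Finset.mem_singleton.1 (Finsupp.support_single_subset hg)]
    exact h i (Finset.mem_range.1 hi) y
  · have := l1_pullAverage_mul_listProd_sub_le (S := S) (L := letters g)
      (fun l hl => Set.mem_biUnion hg ⟨l, hl, rfl⟩) n y
    rw [listProd_letters] at this
    refine this.trans ?_
    have hlen : ((letters g).length : ℝ) ≤ N := by exact_mod_cast hN ⟨g, hg, rfl⟩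
    rw [mul_div_assoc', div_le_iff₀ hn0]
    rw [div_lt_iff₀ hε] at hn
    linarith

end FreeCopies

/-! ### Property A of the graph product -/

section GraphProduct

variable {V : Type u} {Γ : SimpleGraph V} {G : V → Type v} [∀ x, Group (G x)]

theorem hasPropertyA_special_insert [∀ x, Finite (G x)] {x : V} {S : Set V} (hx : x ∉ S)
    (hS : HasPropertyA (special Γ G S)) : HasPropertyA (special Γ G (insert x S)) := by
  let π : special Γ G (insert x S) →* special Γ G S :=
    ((retr Γ G S).comp (special Γ G (insert x S)).subtype).codRestrict _ fun g => retr_mem S _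
  have hπ : Function.Surjective π := fun g =>
    ⟨⟨g, special_mono (Set.subset_insert x S) g.2⟩, Subtype.ext (retr_of_mem g.2)⟩
  have hretr : ∀ g ∈ special Γ G (insert x S), retr Γ G {x}ᶜ g = retr Γ G S g := by
    suffices special Γ G (insert x S) ≤ (retr Γ G {x}ᶜ).eqLocus (retr Γ G S) from
      fun g hg => this hg
    refine special_le.2 fun y hy a => ?_
    change retr Γ G {x}ᶜ _ = retr Γ G S _
    rcases hy with rfl | hy
    · rw [retr_vertexHom_of_notMem (by simp), retr_vertexHom_of_notMem hx]
    · rw [retr_vertexHom_of_mem hy,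
        retr_vertexHom_of_mem (S := {x}ᶜ) (by rintro rfl; exact hx hy)]
  have hker : ∀ g : π.ker, retr Γ G {x}ᶜ (g.1 : GraphProduct Γ G) = 1 := fun g =>
    (hretr _ g.1.2).trans (congrArg Subtype.val (MonoidHom.mem_ker.1 g.2))
  -- On the kernel of the retraction the `rest` component is trivial, so `freePart` is
  -- multiplicative there, and injective by `unsplit_mul_retr`.
  let j : π.ker →* FreeCopies (Walls Γ G x) (G x) :=
    MonoidHom.mk' (fun g => freePart x (g.1 : GraphProduct Γ G)) fun g h => by
      have : (split x (g.1 : GraphProduct Γ G)).right = 1 :=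
        Subtype.ext ((split_right x _).trans (hker g))
      rw [Subgroup.coe_mul, Subgroup.coe_mul, freePart_mul, this, map_one]
      rfl
  have hj : Function.Injective j := by
    intro g h hgh
    refine Subtype.ext (Subtype.ext ?_)
    rw [← unsplit_mul_retr x (g.1 : GraphProduct Γ G), hker,
      ← unsplit_mul_retr x (h.1 : GraphProduct Γ G), hker]
    exact congrArg (fun f => unsplit x f * 1) hgh
  exact HasPropertyA.of_extension hπ hS (HasPropertyA.of_injective hj hasPropertyA_freeCopies)

theorem hasPropertyA_special [∀ x, Finite (G x)] {S : Set V} (hS : S.Finite) :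
    HasPropertyA (special Γ G S) := by
  induction S, hS using Set.Finite.induction_on with
  | empty =>
    have : Subsingleton (special Γ G (∅ : Set V)) := by rw [special_empty]; infer_instance
    exact HasPropertyA.of_subsingleton
  | insert hx _ ih => exact hasPropertyA_special_insert hx ih

theorem hasPropertyA_graphProduct [∀ x, Finite (G x)] : HasPropertyA (GraphProduct Γ G) := by
  refine HasPropertyA.of_locally fun E hE => ?_
  choose S hS hmem using exists_finite_mem_special (Γ := Γ) (G := G)
  exact ⟨special Γ G (⋃ g ∈ E, S g), fun g hg => special_mono (Set.subset_biUnion_of_mem hg)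
    (hmem g), hasPropertyA_special (hE.biUnion fun g _ => hS g)⟩

end GraphProduct

/-! ### Exactness from property A -/

section Exactness

variable {G : Type u} [Group G]

/-- The action of a group on the space of its ultrafilters by left translation. -/
abbrev ultrafilterMulAction : MulAction G (Ultrafilter G) where
  smul g 𝒰 := 𝒰.map (g * ·)
  one_smul 𝒰 := by
    change 𝒰.map (1 * ·) = 𝒰
    simp only [one_mul]
    exact Ultrafilter.map_id' 𝒰
  mul_smul g h 𝒰 := by
    change 𝒰.map (g * h * ·) = (𝒰.map (h * ·)).map (g * ·)
    rw [Ultrafilter.map_map]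
    simp only [Function.comp_def, mul_assoc]

theorem continuous_ultrafilter_map {X Y : Type*} (f : X → Y) :
    Continuous (Ultrafilter.map f) := by
  refine ultrafilterBasis_is_basis.continuous_iff.2 ?_
  rintro _ ⟨s, rfl⟩
  exact ultrafilter_isOpen_basic (f ⁻¹' s)

/-- A family of probability measures with supports in a fixed finite set extends continuously to
the space of ultrafilters. -/
theorem exists_continuous_extension {X Y : Type u} (m : X → Y →₀ ℝ) (F : Finset Y)
    (h0 : ∀ x, 0 ≤ m x) (h1 : ∀ x, mass (m x) = 1) (hF : ∀ x, (m x).support ⊆ F) :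
    ∃ M : Ultrafilter X → Prob Y, Continuous M ∧ (∀ y, Continuous fun 𝒰 => (M 𝒰).weight y) ∧
      (∀ x y, (M (pure x)).weight y = m x y) ∧ ∀ 𝒰, ∀ y ∉ F, (M 𝒰).weight y = 0 := by
  have hle : ∀ x y, m x y ≤ 1 := by
    intro x y
    by_cases hy : y ∈ F
    · rw [← h1 x, mass_eq_sum _ (hF x)]
      exact Finset.single_le_sum (fun z _ => h0 x z) hy
    · rw [Finsupp.notMem_support_iff.1 fun h => hy (hF x h)]; exact zero_le_one
  -- Each weight takes values in a compact Hausdorff space, hence extends; identities for finitely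
  -- many weights then persist by density of the principal ultrafilters.
  let w : Y → Ultrafilter X → unitInterval := fun y =>
    Ultrafilter.extend fun x => ⟨m x y, h0 x y, hle x y⟩
  have hw : ∀ y, Continuous fun 𝒰 => (w y 𝒰 : ℝ) := fun y =>
    continuous_subtype_val.comp (continuous_ultrafilter_extend _)
  have hwp : ∀ y x, (w y (pure x) : ℝ) = m x y := fun y x => by
    simp only [w, ultrafilter_extend_pure]
  have hz : ∀ 𝒰, ∀ y ∉ F, (w y 𝒰 : ℝ) = 0 := by
    intro 𝒰 y hy
    refine denseRange_pure.induction_on 𝒰 (isClosed_eq (hw y) continuous_const) fun x => ?_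
    rw [hwp]
    exact Finsupp.notMem_support_iff.1 fun h => hy (hF x h)
  have hsum : ∀ 𝒰, ∑ y ∈ F, (w y 𝒰 : ℝ) = 1 := by
    intro 𝒰
    refine denseRange_pure.induction_on 𝒰
      (isClosed_eq (continuous_finsetSum _ fun y _ => hw y) continuous_const) fun x => ?_
    simp only [hwp]
    rw [← mass_eq_sum _ (hF x), h1]
  refine ⟨fun 𝒰 => ⟨fun y => w y 𝒰, fun y => (w y 𝒰).2.1, ?_⟩, ?_, hw, fun x y => hwp y x, hz⟩
  · rw [← hsum 𝒰]
    exact hasSum_sum_of_ne_finset_zero (hz 𝒰)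
  · refine continuous_induced_rng.2 (continuous_pi fun φ => ?_)
    have : ∀ 𝒰, ∑' y, ((w y 𝒰 : ℝ) : ℂ) * φ.1 y = ∑ y ∈ F, ((w y 𝒰 : ℝ) : ℂ) * φ.1 y :=
      fun 𝒰 => tsum_eq_sum fun y hy => by rw [hz 𝒰 y hy]; simp
    simp only [Function.comp_def, this]
    exact continuous_finsetSum _ fun y _ =>
      (Complex.continuous_ofReal.comp (hw y)).mul continuous_const

theorem isExact_of_hasPropertyA (hG : HasPropertyA G) : IsExact G := by
  classical
  let _ : MulAction G (Ultrafilter G) := ultrafilterMulAction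
  have hc : ContinuousConstSMul G (Ultrafilter G) := ⟨fun g => continuous_ultrafilter_map _⟩
  refine ⟨Ultrafilter G, inferInstance, inferInstance, ⟨pure 1⟩, inferInstance, inferInstance, hc,
    fun E ε hε => ?_⟩
  obtain ⟨F, a, hF, h0, h1, hs, ha⟩ := hG {g | g⁻¹ ∈ E} (ε / 2)
    (E.finite_toSet.preimage inv_injective.injOn) (half_pos hε)
  -- All `m x` are supported in the one finite set `F`. Left multiplication of `x` by `g` becomes
  -- right multiplication of `x⁻¹` by `g⁻¹`, hence the inverses of `E` above.
  let m : G → G →₀ ℝ := fun x => trans x (a x⁻¹)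
  have hmF : ∀ x, (m x).support ⊆ hF.toFinset := by
    intro x g hg
    rw [Finsupp.mem_support_iff, trans_apply, ← Finsupp.mem_support_iff] at hg
    simpa using hs _ _ hg
  obtain ⟨M, hM, hMw, hMp, hMz⟩ := exists_continuous_extension m hF.toFinset
    (fun x => trans_nonneg _ (h0 _)) (fun x => by rw [mass_trans, h1]) hmF
  refine ⟨M, hM, ε / 2, half_lt_self hε, fun g hg 𝒰 => ?_⟩
  let U : Finset G := hF.toFinset ∪ hF.toFinset.image (g * ·)
  have hU : ∀ 𝒰, Prob.l1Dist (M (g • 𝒰)) (Prob.translate g (M 𝒰)) =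
      ∑ y ∈ U, |(M (g • 𝒰)).weight y - (M 𝒰).weight (g⁻¹ * y)| := by
    intro 𝒰
    refine tsum_eq_sum fun y hy => ?_
    rw [Finset.mem_union, not_or] at hy
    have : g⁻¹ * y ∉ hF.toFinset := fun h =>
      hy.2 (Finset.mem_image.2 ⟨_, h, mul_inv_cancel_left g y⟩)
    rw [hMz _ y hy.1, Prob.translate, hMz _ _ this]
    simp
  rw [hU]
  -- The distance is a finite sum of continuous functions of the ultrafilter, so the bound need only
  -- be checked at principal ones.
  refine denseRange_pure.induction_on 𝒰 (isClosed_le (continuous_finsetSum _ fun y _ =>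
    (((hMw y).comp (continuous_const_smul g)).sub (hMw (g⁻¹ * y))).abs) continuous_const)
    fun x => ?_
  have hp : g • (pure x : Ultrafilter G) = pure (g * x) := Ultrafilter.map_pure _ x
  rw [← hU, hp, Prob.l1Dist_eq (φ := m (g * x)) (ψ := trans g (m x))
    (funext fun y => hMp _ y) (Prob.translate_weight (funext fun y => hMp _ y) g)]
  simp only [m]
  rw [← trans_mul, mul_inv_rev]
  exact (l1_trans_sub_le _ _ _).trans (ha _ _ (by simpa using hg))

end Exactness

/-! ### Common neighbours and the girth -/

section Girth

/-- Two common neighbours of `x` and `y` would give a circuit of length four. -/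
theorem subsingleton_commonNeighbors {V : Type*} {Γ : SimpleGraph V} (h : 4 < Γ.egirth) {x y : V}
    (hxy : x ≠ y) : (Γ.neighborSet x ∩ Γ.neighborSet y).Subsingleton := by
  rintro a ⟨hxa, hya⟩ b ⟨hxb, hyb⟩
  by_contra hab
  rw [SimpleGraph.mem_neighborSet] at hxa hya hxb hyb
  let w : Γ.Walk x x := .cons hxa (.cons hya.symm (.cons hyb (.cons hxb.symm .nil)))
  have hw : w.IsCycle := by
    simp [w, SimpleGraph.Walk.isCycle_def, SimpleGraph.Walk.isTrail_def, hxy, hxy.symm, hab,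
      hxa.ne, hxb.ne, hyb.ne, hxa.ne', hxb.ne', hya.ne']
  have := SimpleGraph.egirth_le_length hw
  exact absurd (h.trans_le this) (by simp [w])

end Girth

end RelBiexact

theorem theorem1p3 {V : Type u} [Countable V] (Γ : SimpleGraph V)
    (hfine : RelBiexact.UniformlyFine Γ) (hhyp : RelBiexact.Hyperbolic Γ)
    (hgirth : 20 < Γ.egirth)
    (G : V → Type v) [∀ x, Group (G x)] [∀ x, Finite (G x)] [∀ x, Nontrivial (G x)] :
    RelBiexact.BiexactRel (Set.range fun x : V => RelBiexact.linkSubgroup Γ G x) := by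
  have : Nonempty V := hhyp.1.nonempty
  have h4 : 4 < Γ.egirth := lt_trans (by norm_num) hgirth
  exact ⟨RelBiexact.isExact_of_hasPropertyA RelBiexact.hasPropertyA_graphProduct,
    RelBiexact.exists_tendstoRel_graphProduct
      (fun _ _ => RelBiexact.subsingleton_commonNeighbors h4) (Set.range_nonempty _)⟩
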